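/- Let $m\in\mathbb N$ and let $f\in C_0^\infty(\mathbb R^m,\mathcal L(\mathbb R^m,\mathbb R^m))$ and $g\in C_0^\infty(\mathbb R^m,\mathbb R^m)$ be smooth with compact support. Let $H^k_{per}=H^k_{per}((-\pi,\pi);\mathbb R^m)$ be the Sobolev space of $2\pi$-periodic functions, with norm $\|u\|_{H^k}^2=\sum_{j\le k}\|\partial_x^ju\|_{L^2(-\pi,\pi)}^2$, and let $\Phi:=H^1_{per}$. Consider the reaction-diffusion-advection system $$\partial_t u-\partial_x^2u+u+f(u)\partial_xu+g(u)=0,\quad x\in(-\pi,\pi),\qquad u|_{t=0}=u_0,$$ with periodic boundary conditions $u|_{x=-\pi}=u|_{x=\pi}$, $\partial_xu|_{x=-\pi}=\partial_xu|_{x=\pi}$. A solution on $[0,T]$ is a function $u\in C([0,T];H^1_{per})\cap L^2(0,T;H^2_{per})$ with $u(0)=u_0$ which is absolutely continuous with values in $L^2(-\pi,\pi)$ and satisfies the equation for almost all $(t,x)\in(0,T)\times(-\pi,\pi)$. Then the following hold. (a) For every $u_0\in\Phi$ and every $T>0$ there is exactly one solution on $[0,T]$. (b) (Dissipativity) There are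 constants $C,\gamma>0$, depending only on $f$, $g$ and $m$, such that every solution $u$ on any interval $[0,T]$ satisfies $$\|u(t)\|_{\Phi}\le Ce^{-\gamma t}\|u_0\|_\Phi+C,\qquad 0\le t\le T.$$ (c) (Smoothing) There are a monotone (non-decreasing) function $Q$ and a constant $C_*>0$, depending only on $f$, $g$ and $m$, such that every solution $u$ on any interval $[0,T]$ satisfies $u(t)\in H^2_{per}$ and $$\|u(t)\|_{H^2}\le t^{-1/2}Q(\|u_0\|_\Phi)+C_*,\qquad 0<t\le T.$$ (d) The maps $S(t):\Phi\to\Phi$, $S(t)u_0:=u(t)$, $t\ge0$, form a semigroup, that is, $S(0)=\mathrm{Id}$ and $S(t+s)=S(t)S(s)$ for $t,s\ge0$, and this semigroup possesses a global attractor $\mathcal A\subset\Phi$: the set $\mathcal A$ is compact in $\Phi$, $S(t)\mathcal A=\mathcal A$ for all $t\ge0$, and for every bounded set $B\subset\Phi$ and every neighbourhood $\mathcal O$ of $\mathcal A$ in $\Phi$ there is a time $T\ge 0$ such that $S(t)B\subset\mathcal O$ for all $t\ge T$. Moreover, $\mathcal A$ is a bounded subset of $H^2_{per}$. -/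

import Mathlib

open Set Filter Topology MeasureTheory
open scoped ContDiff

noncomputable section

namespace RDA

/-- The space `ℝᵐ` with its Euclidean norm. -/
abbrev E (m : ℕ) : Type := EuclideanSpace ℝ (Fin m)

/-- Lebesgue measure on the interval `(-π, π)`. -/
abbrev μ : Measure ℝ := volume.restrict (Ioo (-Real.pi) Real.pi)

/-- The space `L²((-π, π); ℝᵐ)`. -/
abbrev L2 (m : ℕ) : Type := Lp (E m) 2 μ

/-- `v` is the weak derivative of `u` as `2π`-periodic functions, i.e. the integration by parts
formula holds against every smooth `2π`-periodic test function. -/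
def IsPerWeakDeriv {m : ℕ} (u v : L2 m) : Prop :=
  ∀ φ : ℝ → ℝ, ContDiff ℝ ∞ φ → Function.Periodic φ (2 * Real.pi) →
    ∫ x, deriv φ x • u x ∂μ = -∫ x, φ x • v x ∂μ

theorem integrable_smul {m : ℕ} {φ : ℝ → ℝ} (hφ : Continuous φ) (u : L2 m) :
    Integrable (fun x => φ x • u x) μ := by
  have hu : Integrable (fun x => u x) μ := (Lp.memLp u).integrable (by norm_num)
  obtain ⟨C, hC⟩ := (isCompact_Icc (a := -Real.pi) (b := Real.pi)).exists_bound_of_continuousOn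
    hφ.continuousOn
  refine hu.bdd_smul C hφ.aestronglyMeasurable ?_
  filter_upwards [ae_restrict_mem measurableSet_Ioo] with x hx
  exact hC x (Ioo_subset_Icc_self hx)

theorem isPerWeakDeriv_zero {m : ℕ} : IsPerWeakDeriv (0 : L2 m) 0 := by
  intro φ _ _
  have h : ∀ ψ : ℝ → ℝ, ∫ x, ψ x • (0 : L2 m) x ∂μ = 0 := by
    intro ψ
    refine integral_eq_zero_of_ae ?_
    filter_upwards [Lp.coeFn_zero (E m) 2 μ] with x hx
    rw [hx, Pi.zero_apply, smul_zero]
  rw [h, h, neg_zero]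

theorem IsPerWeakDeriv.add {m : ℕ} {u₁ v₁ u₂ v₂ : L2 m} (h₁ : IsPerWeakDeriv u₁ v₁)
    (h₂ : IsPerWeakDeriv u₂ v₂) : IsPerWeakDeriv (u₁ + u₂) (v₁ + v₂) := by
  intro φ hφ hp
  have key : ∀ ψ : ℝ → ℝ, Continuous ψ → ∀ a b : L2 m,
      ∫ x, ψ x • (a + b) x ∂μ = ∫ x, ψ x • a x ∂μ + ∫ x, ψ x • b x ∂μ := by
    intro ψ hψ a b
    rw [← integral_add (integrable_smul hψ a) (integrable_smul hψ b)]
    refine integral_congr_ae ?_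
    filter_upwards [Lp.coeFn_add a b] with x hx
    rw [hx, Pi.add_apply, smul_add]
  rw [key _ (hφ.continuous_deriv (by norm_num)), key _ hφ.continuous, h₁ φ hφ hp, h₂ φ hφ hp,
    neg_add]

theorem IsPerWeakDeriv.smul {m : ℕ} {u v : L2 m} (c : ℝ) (h : IsPerWeakDeriv u v) :
    IsPerWeakDeriv (c • u) (c • v) := by
  intro φ hφ hp
  have key : ∀ ψ : ℝ → ℝ, ∀ a : L2 m,
      ∫ x, ψ x • (c • a) x ∂μ = c • ∫ x, ψ x • a x ∂μ := by
    intro ψ a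
    rw [← integral_smul]
    refine integral_congr_ae ?_
    filter_upwards [Lp.coeFn_smul c a] with x hx
    simp only [hx, Pi.smul_apply]
    rw [smul_comm]
  rw [key, key, h φ hφ hp, smul_neg]

/-- The periodic Sobolev space `H^k_per((-π, π); ℝᵐ)`: an element is the tuple
`(u, ∂ₓu, …, ∂ₓᵏu)` of a function in `L²` and its periodic weak derivatives, and the norm is
`‖u‖ = (∑_{j ≤ k} ‖∂ₓʲu‖²_{L²})^{1/2}`. -/
def Hper (m k : ℕ) : Submodule ℝ (PiLp 2 (fun _ : Fin (k + 1) => L2 m)) where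
  carrier := {p | ∀ i : Fin k, IsPerWeakDeriv (p i.castSucc) (p i.succ)}
  zero_mem' := fun _ => isPerWeakDeriv_zero
  add_mem' := fun ha hb i => (ha i).add (hb i)
  smul_mem' := fun c _ ha i => (ha i).smul c

/-- The `j`-th (weak) spatial derivative of `u ∈ H^k_per`, for `j ≤ k`; for `j = 0` this is `u`
itself. -/
def D {m k : ℕ} (j : Fin (k + 1)) (u : Hper m k) : L2 m := (u : PiLp 2 fun _ => L2 m) j

/-- The embedding `H²_per → H¹_per`. -/
def toH1 {m : ℕ} (u : Hper m 2) : Hper m 1 :=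
  ⟨WithLp.toLp 2 (fun i : Fin 2 => D i.castSucc u), fun i => u.2 i.castSucc⟩

/-- `u ∈ C([0,T]; H¹_per) ∩ L²(0,T; H²_per)` solves
`∂ₜu - ∂ₓ²u + u + f(u)∂ₓu + g(u) = 0`, with periodic boundary conditions, on the time interval
`[0,T]`, and `u(0) = u₀`. The function `U` is `u` as an element of `L²(0,T; H²_per)`, and `ut` is
the time derivative of `u` as a function with values in `L²(-π, π)`; the equation holds for almost
all `t` and `x`. -/
structure IsSolution {m : ℕ} (f : E m → (E m →L[ℝ] E m)) (g : E m → E m) (T : ℝ)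
    (u₀ : Hper m 1) (u : ℝ → Hper m 1) : Prop where
  continuousOn : ContinuousOn u (Icc 0 T)
  initial : u 0 = u₀
  equation : ∃ (U : ℝ → Hper m 2) (ut : ℝ → L2 m),
    MemLp U 2 (volume.restrict (Ioo 0 T)) ∧
    (∀ᵐ t ∂(volume.restrict (Ioo 0 T)), toH1 (U t) = u t) ∧
    IntervalIntegrable ut volume 0 T ∧
    (∀ t ∈ Icc 0 T, D 0 (u t) = D 0 (u 0) + ∫ s in (0 : ℝ)..t, ut s) ∧
    ∀ᵐ t ∂(volume.restrict (Ioo 0 T)), ∀ᵐ x ∂μ,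
      ut t x - D 2 (U t) x + D 0 (U t) x + f (D 0 (U t) x) (D 1 (U t) x) + g (D 0 (U t) x) = 0

/-- `S` (considered for times `t ≥ 0`) is the semigroup of solution operators `u₀ ↦ u(t)`. -/
structure IsSolutionSemigroup {m : ℕ} (f : E m → (E m →L[ℝ] E m)) (g : E m → E m)
    (S : ℝ → Hper m 1 → Hper m 1) : Prop where
  isSolution : ∀ u₀ : Hper m 1, ∀ T : ℝ, 0 < T → IsSolution f g T u₀ (fun t => S t u₀)
  zero : ∀ u₀ : Hper m 1, S 0 u₀ = u₀
  add : ∀ s t : ℝ, 0 ≤ s → 0 ≤ t → ∀ u₀ : Hper m 1, S (s + t) u₀ = S s (S t u₀)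

/-- `A` is a global attractor of `S`: it is compact, strictly invariant, and every neighbourhood of
`A` absorbs every bounded set. -/
structure IsGlobalAttractor {X : Type*} [PseudoMetricSpace X] (S : ℝ → X → X) (A : Set X) :
    Prop where
  isCompact : IsCompact A
  invariant : ∀ t : ℝ, 0 ≤ t → S t '' A = A
  attracting : ∀ B : Set X, Bornology.IsBounded B → ∀ O ∈ 𝓝ˢ A,
    ∃ T : ℝ, 0 ≤ T ∧ ∀ t : ℝ, T ≤ t → S t '' B ⊆ O

end RDA

end

/-! The equation is semilinear parabolic, `∂ₜu + Au = N(u)` with `A = 1 - ∂ₓ²` and `N(u) = -f(u)∂ₓu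
- g(u)`. In one space dimension `H¹` embeds in `L^∞`, so `N` is locally Lipschitz from `H¹` to `L²`;
it also grows at most linearly, so Picard iteration for the linear problem converges on all of
`[0,T]` (`IsTame.exists_isMildSol`).

All analysis is done on Fourier coefficients in a real trigonometric basis. There `A` is diagonal
with eigenvalues `1 + n²`, and the equation becomes a family of scalar ODEs (`IsMild`), equivalent
to `IsSolution` by `IsTame.isSolution_of_isMildSol` and `IsTame.isMildSol_of_isSolution`.

Dissipativity: `f` and `g` have compact support, so `|f(u)||u|` and `|g(u)||u|` are bounded. The
nonlinear term in the `L²` energy balance is then only linear in `∂ₓu` and is absorbed by diffusion.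
A large multiple of the `L²` energy, added to the squared `H¹` norm, satisfies a Gronwall inequality
with negative rate (`IsTame.exists_dissipative`).

Smoothing: along orbits bounded in `H¹` the flow is Lipschitz in `L²` (`IsTame.exists_stable`).
Comparing a solution with its own time translates bounds `‖∂ₜu(t)‖²` by a multiple of its average
over `[0,t]`, and the parabolic energy estimate bounds `∫‖∂ₜu‖²`. So `t‖∂ₜu(t)‖²` is bounded, and
`Au = N(u) - ∂ₜu` gives the `H²` bound.

Attractor: dissipativity and smoothing yield an absorbing ball of `H²`, compact in `H¹`. Stability
in `L²` interpolated with the `H²` bound makes each `S(t)` continuous on it, and the attractor is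
its ω-limit set. -/

noncomputable section

namespace RDA

/-! ### A real trigonometric Hilbert basis of `L²` -/

/-- The element `x ↦ φ x • w` of `L²`. -/
def sm {m : ℕ} (φ : C(ℝ, ℝ)) (w : E m) : L2 m :=
  MemLp.toLp (fun x => φ x • w) (by
    obtain ⟨C, hC⟩ := (isCompact_Icc (a := -Real.pi) (b := Real.pi)).exists_bound_of_continuousOn
      φ.continuous.continuousOn
    refine MemLp.of_bound (by fun_prop) (C * ‖w‖) ?_
    filter_upwards [ae_restrict_mem measurableSet_Ioo] with x hx
    rw [norm_smul]
    exact mul_le_mul_of_nonneg_right (hC x (Ioo_subset_Icc_self hx)) (norm_nonneg _))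

theorem coeFn_sm {m : ℕ} (φ : C(ℝ, ℝ)) (w : E m) : (sm φ w : ℝ → E m) =ᵐ[μ] fun x => φ x • w :=
  MemLp.coeFn_toLp _

theorem inner_sm {m : ℕ} (φ : C(ℝ, ℝ)) (w : E m) (u : L2 m) :
    inner ℝ (sm φ w) u = inner ℝ w (∫ x, φ x • u x ∂μ) := by
  rw [L2.inner_def, ← integral_inner (integrable_smul φ.continuous u)]
  refine integral_congr_ae ?_
  filter_upwards [coeFn_sm φ w] with x hx
  rw [hx, real_inner_smul_left, real_inner_smul_right]

theorem inner_sm_sm {m : ℕ} (φ ψ : C(ℝ, ℝ)) (w v : E m) :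
    inner ℝ (sm φ w) (sm ψ v) = (∫ x in (-Real.pi)..Real.pi, φ x * ψ x) * inner ℝ w v := by
  rw [inner_sm, intervalIntegral.integral_of_le (by linarith [Real.pi_pos]),
    ← integral_Ioc_eq_integral_Ioo.symm]
  have : ∫ x, φ x • (sm ψ v : ℝ → E m) x ∂μ = ∫ x, (φ x * ψ x) • v ∂μ := by
    refine integral_congr_ae ?_
    filter_upwards [coeFn_sm ψ v] with x hx
    rw [hx, smul_smul]
  rw [this, integral_smul_const, real_inner_smul_right]

/-- The function `x ↦ (2π)^{-1/2} (cos n x + sin n x)`. -/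
def cas (n : ℤ) : C(ℝ, ℝ) :=
  ⟨fun x => (√(2 * Real.pi))⁻¹ * (Real.cos (n * x) + Real.sin (n * x)), by fun_prop⟩

theorem contDiff_cas (n : ℤ) : ContDiff ℝ ∞ (cas n) := by
  simp only [cas, ContinuousMap.coe_mk]
  fun_prop

theorem periodic_cas (n : ℤ) : Function.Periodic (cas n) (2 * Real.pi) := by
  intro x
  simp only [cas, ContinuousMap.coe_mk]
  have : (n : ℝ) * (x + 2 * Real.pi) = n * x + n * (2 * Real.pi) := by ring
  rw [this, Real.cos_add_int_mul_two_pi, Real.sin_add_int_mul_two_pi]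

/-- Differentiation only flips the frequency. This is the advantage of `cos + sin` over separate
sines and cosines: one real family indexed by `ℤ` suffices. -/
theorem hasDerivAt_cas (n : ℤ) (x : ℝ) : HasDerivAt (cas n) (n * cas (-n) x) x := by
  simp only [cas, ContinuousMap.coe_mk]
  have h : HasDerivAt (fun y : ℝ => (n : ℝ) * y) n x := by
    simpa using (hasDerivAt_id x).const_mul (n : ℝ)
  convert! (h.cos.add h.sin).const_mul (√(2 * Real.pi))⁻¹ using 1
  push_cast
  rw [neg_mul, Real.cos_neg, Real.sin_neg]
  ring

theorem integral_cos_int (k : ℤ) :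
    ∫ x in (-Real.pi)..Real.pi, Real.cos (k * x) = if k = 0 then 2 * Real.pi else 0 := by
  split_ifs with h
  · simp [h]; ring
  · have h' : (k : ℝ) ≠ 0 := by exact_mod_cast h
    rw [intervalIntegral.integral_comp_mul_left (fun x => Real.cos x) h', integral_cos]
    simp

theorem integral_sin_int (k : ℤ) :
    ∫ x in (-Real.pi)..Real.pi, Real.sin (k * x) = 0 := by
  by_cases h : k = 0
  · simp [h]
  · have h' : (k : ℝ) ≠ 0 := by exact_mod_cast h
    rw [intervalIntegral.integral_comp_mul_left (fun x => Real.sin x) h', integral_sin]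
    simp

theorem integral_cas_mul_cas (n k : ℤ) :
    ∫ x in (-Real.pi)..Real.pi, cas n x * cas k x = if n = k then 1 else 0 := by
  have h : ∀ x, cas n x * cas k x = (2 * Real.pi)⁻¹ *
      (Real.cos ((n - k : ℤ) * x) + Real.sin ((n + k : ℤ) * x)) := by
    intro x
    have hs : (√(2 * Real.pi))⁻¹ * (√(2 * Real.pi))⁻¹ = (2 * Real.pi)⁻¹ := by
      rw [← mul_inv, Real.mul_self_sqrt (by positivity)]
    simp only [cas, ContinuousMap.coe_mk]
    push_cast
    rw [sub_mul, add_mul, Real.cos_sub, Real.sin_add, ← hs]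
    ring
  simp_rw [h]
  rw [intervalIntegral.integral_const_mul, intervalIntegral.integral_add
    (Continuous.intervalIntegrable (by fun_prop) _ _)
    (Continuous.intervalIntegrable (by fun_prop) _ _), integral_cos_int, integral_sin_int]
  simp only [sub_eq_zero]
  split_ifs
  · rw [add_zero, inv_mul_cancel₀ (by positivity)]
  · simp

/-- The real trigonometric functions with values in the coordinate directions. -/
def trig {m : ℕ} (κ : ℤ × Fin m) : L2 m := sm (cas κ.1) (EuclideanSpace.single κ.2 1)

theorem orthonormal_trig (m : ℕ) : Orthonormal ℝ (trig (m := m)) := by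
  classical
  rw [orthonormal_iff_ite]
  rintro ⟨n, i⟩ ⟨k, j⟩
  rw [trig, trig, inner_sm_sm, integral_cas_mul_cas]
  simp only [EuclideanSpace.inner_single_left, Prod.mk.injEq]
  by_cases h1 : n = k <;> by_cases h2 : i = j <;> simp [h1, h2]

/-- A function orthogonal to all trigonometric functions is orthogonal to all continuous
functions that take the same value at both end points. -/
theorem integral_smul_eq_zero {h : ℝ → ℝ} (hh : Integrable h μ)
    (h0 : ∀ n : ℤ, ∫ x, cas n x * h x ∂μ = 0) {φ : ℝ → ℝ} (hφ : Continuous φ)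
    (hp : φ (-Real.pi) = φ Real.pi) : ∫ x, φ x * h x ∂μ = 0 := by
  have : Fact (0 < 2 * Real.pi) := ⟨by positivity⟩
  have hint : ∀ ψ : C(AddCircle (2 * Real.pi), ℂ),
      Integrable (fun x : ℝ => ψ x * (h x : ℂ)) μ := by
    intro ψ
    refine hh.ofReal.bdd_mul (c := ‖ψ‖) ?_ (ae_of_all _ fun x => ψ.norm_coe_le_norm _)
    exact (ψ.continuous.comp (AddCircle.continuous_mk' _)).aestronglyMeasurable
  -- Pairing with `h` is made a complex functional on the circle, so that density of the Fourier
  -- exponentials in the continuous functions applies.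
  let Λ : C(AddCircle (2 * Real.pi), ℂ) →ₗ[ℂ] ℂ :=
    { toFun := fun ψ => ∫ x : ℝ, ψ x * (h x : ℂ) ∂μ
      map_add' := fun a b => by
        rw [← integral_add (hint a) (hint b)]
        simp [add_mul]
      map_smul' := fun c a => by
        simp only [ContinuousMap.coe_smul, Pi.smul_apply, smul_eq_mul, mul_assoc, RingHom.id_apply]
        rw [integral_const_mul] }
  let Λc : C(AddCircle (2 * Real.pi), ℂ) →L[ℂ] ℂ := Λ.mkContinuous (∫ x, ‖h x‖ ∂μ) (by
    intro ψ
    refine (norm_integral_le_integral_norm _).trans ?_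
    rw [mul_comm (∫ x, ‖h x‖ ∂μ), ← integral_const_mul]
    refine integral_mono (hint ψ).norm (hh.norm.const_mul _) fun x => ?_
    simp only [norm_mul, Complex.norm_real]
    exact mul_le_mul_of_nonneg_right (ψ.norm_coe_le_norm _) (norm_nonneg _))
  -- The frequencies `n` and `-n` together separate the cosine from the sine.
  have hcos : ∀ n : ℤ, ∫ x, Real.cos (n * x) * h x ∂μ = 0 ∧
      ∫ x, Real.sin (n * x) * h x ∂μ = 0 := by
    intro n
    have hic : Integrable (fun x : ℝ => Real.cos (n * x) * h x) μ :=
      hh.bdd_mul (c := 1) (by fun_prop) (ae_of_all _ fun x => Real.abs_cos_le_one _)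
    have his : Integrable (fun x : ℝ => Real.sin (n * x) * h x) μ :=
      hh.bdd_mul (c := 1) (by fun_prop) (ae_of_all _ fun x => Real.abs_sin_le_one _)
    have hs : (√(2 * Real.pi))⁻¹ ≠ 0 := by positivity
    have h1 := h0 n
    have h2 := h0 (-n)
    simp only [cas, ContinuousMap.coe_mk, mul_assoc, add_mul, integral_const_mul, mul_eq_zero, hs,
      false_or, Int.cast_neg, neg_mul, Real.cos_neg, Real.sin_neg] at h1 h2
    rw [integral_add hic his] at h1
    rw [integral_add hic his.fun_neg, integral_neg] at h2
    constructor <;> linarith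
  have hΛ : ∀ ψ, Λc ψ = 0 := by
    have hle : (Submodule.span ℂ (range (@fourier (2 * Real.pi)))).topologicalClosure ≤
        LinearMap.ker (Λc : C(AddCircle (2 * Real.pi), ℂ) →ₗ[ℂ] ℂ) := by
      refine Submodule.topologicalClosure_minimal _ ?_ Λc.isClosed_ker
      rw [Submodule.span_le]
      rintro _ ⟨n, rfl⟩
      change ∫ x : ℝ, fourier n (x : AddCircle (2 * Real.pi)) * (h x : ℂ) ∂μ = 0
      have he : ∀ x : ℝ, fourier n (x : AddCircle (2 * Real.pi)) * (h x : ℂ) =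
          ((Real.cos (n * x) * h x : ℝ) : ℂ) + ((Real.sin (n * x) * h x : ℝ) : ℂ) * Complex.I := by
        intro x
        rw [fourier_coe_apply]
        have : 2 * (Real.pi : ℂ) * Complex.I * n * x / ((2 * Real.pi : ℝ) : ℂ) =
            ((n * x : ℝ) : ℂ) * Complex.I := by
          have : (Real.pi : ℂ) ≠ 0 := by exact_mod_cast Real.pi_ne_zero
          push_cast
          field_simp
        rw [this, Complex.exp_mul_I, ← Complex.ofReal_cos, ← Complex.ofReal_sin]
        push_cast
        ring
      simp_rw [he]
      have hic : Integrable (fun x : ℝ => Real.cos (n * x) * h x) μ :=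
        hh.bdd_mul (c := 1) (by fun_prop) (ae_of_all _ fun x => Real.abs_cos_le_one _)
      have his : Integrable (fun x : ℝ => Real.sin (n * x) * h x) μ :=
        hh.bdd_mul (c := 1) (by fun_prop) (ae_of_all _ fun x => Real.abs_sin_le_one _)
      rw [integral_add hic.ofReal (his.ofReal.mul_const _), integral_mul_const,
        integral_complex_ofReal, integral_complex_ofReal, (hcos n).1, (hcos n).2]
      simp
    intro ψ
    rw [span_fourier_closure_eq_top] at hle
    exact hle (Submodule.mem_top (x := ψ))
  let ψ : C(AddCircle (2 * Real.pi), ℂ) :=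
    ⟨AddCircle.liftIco (2 * Real.pi) (-Real.pi) (fun x => (φ x : ℂ)),
      AddCircle.liftIco_continuous (by rw [hp]; congr 2; ring) (by fun_prop)⟩
  have hψ : ∫ x : ℝ, ψ x * (h x : ℂ) ∂μ = 0 := hΛ ψ
  have hψ' : ∫ x : ℝ, ψ x * (h x : ℂ) ∂μ = ∫ x : ℝ, ((φ x * h x : ℝ) : ℂ) ∂μ := by
    refine integral_congr_ae ?_
    filter_upwards [ae_restrict_mem measurableSet_Ioo] with x hx
    have : ψ x = (φ x : ℂ) := by
      refine AddCircle.liftIco_coe_apply (f := fun x => (φ x : ℂ)) ⟨hx.1.le, ?_⟩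
      linarith [hx.2]
    rw [this]
    push_cast
    rfl
  rw [hψ', integral_complex_ofReal] at hψ
  exact_mod_cast hψ

/-- Test functions supported in the open interval vanish at both end points, so the preceding result
applies to each coordinate of `u` and the fundamental lemma of the calculus of variations gives `u =
0`. -/
theorem orthogonal_span_trig (m : ℕ) : (Submodule.span ℝ (range (trig (m := m))))ᗮ = ⊥ := by
  rw [Submodule.eq_bot_iff]
  intro u hu
  have hu' : ∀ κ : ℤ × Fin m, inner ℝ (trig κ) u = 0 := fun κ =>
    (Submodule.mem_orthogonal _ _).1 hu _ (Submodule.subset_span ⟨κ, rfl⟩)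
  have hui : Integrable (fun x => u x) μ := (Lp.memLp u).integrable (by norm_num)
  have key : ∀ φ : ℝ → ℝ, Continuous φ → φ (-Real.pi) = φ Real.pi →
      ∫ x, φ x • u x ∂μ = 0 := by
    intro φ hφ hp
    ext i
    have hcoord : ∀ ψ : C(ℝ, ℝ), inner ℝ (sm ψ (EuclideanSpace.single i 1)) u =
        ∫ x, ψ x * (u x) i ∂μ := by
      intro ψ
      rw [inner_sm, ← integral_inner (integrable_smul ψ.continuous u)]
      refine integral_congr_ae (ae_of_all _ fun x => ?_)
      simp [EuclideanSpace.inner_single_left]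
    have h1 := integral_smul_eq_zero (h := fun x => (u x) i)
      (by simpa [EuclideanSpace.inner_single_left] using
        hui.const_inner (𝕜 := ℝ) (EuclideanSpace.single i (1 : ℝ)))
      (fun n => by rw [← hcoord]; exact hu' (n, i)) hφ hp
    have h2 := hcoord ⟨φ, hφ⟩
    rw [inner_sm] at h2
    simp only [ContinuousMap.coe_mk, h1, EuclideanSpace.inner_single_left] at h2
    simpa using h2
  have hae := isOpen_Ioo.ae_eq_zero_of_integral_contDiff_smul_eq_zero
    (μ := μ) (f := fun x => u x) (U := Ioo (-Real.pi) Real.pi) (hui.locallyIntegrable.locallyIntegrableOn _)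
    (fun φ hφ _ hs => by
      refine key φ hφ.continuous ?_
      rw [image_eq_zero_of_notMem_tsupport (f := φ) fun h => by simpa using hs h,
        image_eq_zero_of_notMem_tsupport (f := φ) fun h => by simpa using hs h])
  refine (Lp.eq_zero_iff_ae_eq_zero).2 ?_
  filter_upwards [hae, ae_restrict_mem measurableSet_Ioo] with x hx hm
  exact hx hm

/-- The Hilbert basis of `L²` made of the trigonometric functions. -/
def basis (m : ℕ) : HilbertBasis (ℤ × Fin m) ℝ (L2 m) :=
  HilbertBasis.mkOfOrthogonalEqBot (orthonormal_trig m) (orthogonal_span_trig m)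

/-- The Fourier coefficient of index `κ`. -/
def cf {m : ℕ} (κ : ℤ × Fin m) : L2 m →L[ℝ] ℝ := innerSL ℝ (trig κ)

theorem cf_apply {m : ℕ} (κ : ℤ × Fin m) (u : L2 m) : cf κ u = inner ℝ (trig κ) u := rfl

theorem basis_repr {m : ℕ} (u : L2 m) (κ : ℤ × Fin m) : (basis m).repr u κ = cf κ u := by
  rw [HilbertBasis.repr_apply_apply, cf_apply, basis, HilbertBasis.coe_mkOfOrthogonalEqBot]

theorem basis_apply {m : ℕ} (κ : ℤ × Fin m) : basis m κ = trig κ := by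
  rw [basis, HilbertBasis.coe_mkOfOrthogonalEqBot]

theorem hasSum_cf_smul {m : ℕ} (u : L2 m) : HasSum (fun κ => cf κ u • trig κ) u := by
  simpa only [basis_repr, basis_apply] using (basis m).hasSum_repr u

theorem hasSum_cf_mul_cf {m : ℕ} (u v : L2 m) :
    HasSum (fun κ => cf κ u * cf κ v) (inner ℝ u v) := by
  have := (basis m).hasSum_inner_mul_inner u v
  simp only [basis_apply] at this
  refine this.congr_fun fun κ => ?_
  rw [cf_apply, cf_apply, real_inner_comm]

theorem hasSum_cf_sq {m : ℕ} (u : L2 m) : HasSum (fun κ => cf κ u ^ 2) (‖u‖ ^ 2) := by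
  rw [← real_inner_self_eq_norm_sq]
  simpa only [sq] using hasSum_cf_mul_cf u u

theorem ext_cf {m : ℕ} {u v : L2 m} (h : ∀ κ, cf κ u = cf κ v) : u = v := by
  have h1 := hasSum_cf_smul u
  simp only [h] at h1
  exact h1.unique (hasSum_cf_smul v)

theorem exists_cf_eq {m : ℕ} {c : ℤ × Fin m → ℝ} (hc : Summable fun κ => c κ ^ 2) :
    ∃ u : L2 m, ∀ κ, cf κ u = c κ := by
  have hm : Memℓp c 2 := by
    refine memℓp_gen ?_
    simpa using hc
  refine ⟨(basis m).repr.symm ⟨c, hm⟩, fun κ => ?_⟩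
  rw [← basis_repr, LinearIsometryEquiv.apply_symm_apply]

theorem sum_cf_sq_le {m : ℕ} (u : L2 m) (s : Finset (ℤ × Fin m)) :
    ∑ κ ∈ s, cf κ u ^ 2 ≤ ‖u‖ ^ 2 :=
  sum_le_hasSum s (fun _ _ => sq_nonneg _) (hasSum_cf_sq u)

/-! ### Weak derivatives and Sobolev norms through Fourier coefficients -/

/-- The index reflected in the frequency. -/
def refl (m : ℕ) : ℤ × Fin m ≃ ℤ × Fin m := (Equiv.neg ℤ).prodCongr (Equiv.refl _)

theorem refl_fst {m : ℕ} (κ : ℤ × Fin m) : (refl m κ).1 = -κ.1 := rfl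

theorem refl_refl {m : ℕ} (κ : ℤ × Fin m) : refl m (refl m κ) = κ :=
  Prod.ext (neg_neg κ.1) (Eq.refl κ.2)

theorem IsPerWeakDeriv.cf_eq {m : ℕ} {u v : L2 m} (h : IsPerWeakDeriv u v) (κ : ℤ × Fin m) :
    cf κ v = -κ.1 * cf (refl m κ) u := by
  have h1 := h (cas κ.1) (contDiff_cas _) (periodic_cas _)
  simp only [cf_apply, trig, inner_sm]
  have h2 : deriv (cas κ.1) = fun x => (κ.1 : ℝ) * cas (-κ.1) x :=
    funext fun x => (hasDerivAt_cas κ.1 x).deriv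
  simp only [h2, mul_smul, integral_smul] at h1
  rw [← neg_eq_iff_eq_neg.2 h1, inner_neg_right, real_inner_smul_right]
  simp [refl]

theorem cf_sm_deriv {m : ℕ} {φ : ℝ → ℝ} (hφ : ContDiff ℝ ∞ φ)
    (hp : Function.Periodic φ (2 * Real.pi)) (w : E m) (κ : ℤ × Fin m) :
    cf κ (sm ⟨deriv φ, hφ.continuous_deriv (by norm_num)⟩ w) =
      -κ.1 * cf (refl m κ) (sm ⟨φ, hφ.continuous⟩ w) := by
  have hd : Continuous (deriv φ) := hφ.continuous_deriv (by norm_num)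
  simp only [cf_apply, trig, inner_sm_sm, ContinuousMap.coe_mk]
  have e1 : φ (-Real.pi) = φ Real.pi := by
    have := hp (-Real.pi)
    rw [← this]
    congr 1
    ring
  have e2 : cas κ.1 (-Real.pi) = cas κ.1 Real.pi := by
    have := periodic_cas κ.1 (-Real.pi)
    rw [← this]
    congr 1
    ring
  rw [intervalIntegral.integral_mul_deriv_eq_deriv_mul (u := cas κ.1) (v := φ)
    (fun x _ => hasDerivAt_cas κ.1 x)
    (fun x _ => (hφ.differentiable (by norm_num)).differentiableAt.hasDerivAt)
    (Continuous.intervalIntegrable (by fun_prop) _ _) (hd.intervalIntegrable _ _), e1, e2]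
  simp only [mul_assoc, intervalIntegral.integral_const_mul, refl]
  simp [mul_assoc]

/-- Parseval turns both sides of the integration by parts formula into series; reindexing one of
them by `refl` matches them term by term. -/
theorem isPerWeakDeriv_of_cf {m : ℕ} {u v : L2 m}
    (h : ∀ κ, cf κ v = -κ.1 * cf (refl m κ) u) : IsPerWeakDeriv u v := by
  intro φ hφ hp
  have hd : Continuous (deriv φ) := hφ.continuous_deriv (by norm_num)
  refine ext_inner_left ℝ fun w => ?_
  have h1 := hasSum_cf_mul_cf (sm ⟨deriv φ, hd⟩ w) u
  have h2 := (hasSum_cf_mul_cf (sm ⟨φ, hφ.continuous⟩ w) v).neg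
  rw [inner_sm] at h1 h2
  rw [← (refl m).hasSum_iff] at h1
  rw [inner_neg_right]
  refine h1.unique (h2.congr_fun fun κ => ?_)
  simp only [Function.comp_apply, cf_sm_deriv hφ hp, h, refl_refl, refl_fst]
  push_cast
  ring

theorem isPerWeakDeriv_iff {m : ℕ} {u v : L2 m} :
    IsPerWeakDeriv u v ↔ ∀ κ, cf κ v = -κ.1 * cf (refl m κ) u :=
  ⟨IsPerWeakDeriv.cf_eq, isPerWeakDeriv_of_cf⟩

/-- The `j`-th derivative as a continuous linear map. -/
def DL {m k : ℕ} (j : Fin (k + 1)) : Hper m k →L[ℝ] L2 m :=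
  (PiLp.proj 2 (fun _ : Fin (k + 1) => L2 m) j).comp (Hper m k).subtypeL

theorem DL_apply {m k : ℕ} (j : Fin (k + 1)) (u : Hper m k) : DL j u = D j u := rfl

theorem D_sub {m k : ℕ} (j : Fin (k + 1)) (u v : Hper m k) : D j (u - v) = D j u - D j v := rfl

theorem norm_sq_Hper {m k : ℕ} (u : Hper m k) : ‖u‖ ^ 2 = ∑ j, ‖D j u‖ ^ 2 :=
  PiLp.norm_sq_eq_of_L2 _ _

theorem cf_D_succ {m k : ℕ} (u : Hper m k) (j : Fin k) (κ : ℤ × Fin m) :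
    cf κ (D j.succ u) = -κ.1 * cf (refl m κ) (D j.castSucc u) :=
  (u.2 j).cf_eq κ

/-- The eigenvalues of `1 - ∂ₓ²`. -/
def lam {m : ℕ} (κ : ℤ × Fin m) : ℝ := 1 + (κ.1 : ℝ) ^ 2

theorem one_le_lam {m : ℕ} (κ : ℤ × Fin m) : 1 ≤ lam κ := by
  unfold lam; nlinarith [sq_nonneg (κ.1 : ℝ)]

theorem lam_pos {m : ℕ} (κ : ℤ × Fin m) : 0 < lam κ := one_pos.trans_le (one_le_lam κ)

/-- The Fourier coefficient of an element of `H¹`. -/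
def co {m : ℕ} (κ : ℤ × Fin m) : Hper m 1 →L[ℝ] ℝ := (cf κ).comp (DL 0)

theorem co_apply {m : ℕ} (κ : ℤ × Fin m) (u : Hper m 1) : co κ u = cf κ (D 0 u) := rfl

theorem hasSum_cf_D1 {m : ℕ} (u : Hper m 1) :
    HasSum (fun κ => (κ.1 : ℝ) ^ 2 * co κ u ^ 2) (‖D 1 u‖ ^ 2) := by
  have h := hasSum_cf_sq (D 1 u)
  rw [← (refl m).hasSum_iff] at h
  refine h.congr_fun fun κ => ?_
  have := cf_D_succ u 0 (refl m κ)
  simp only [Fin.succ_zero_eq_one, Fin.castSucc_zero, refl_refl, refl_fst] at this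
  simp only [Function.comp_apply, this, co_apply]
  push_cast
  ring

theorem norm_sq_H1 {m : ℕ} (u : Hper m 1) : ‖u‖ ^ 2 = ‖D 0 u‖ ^ 2 + ‖D 1 u‖ ^ 2 := by
  rw [norm_sq_Hper, Fin.sum_univ_two]

theorem hasSum_norm_H1 {m : ℕ} (u : Hper m 1) :
    HasSum (fun κ => lam κ * co κ u ^ 2) (‖u‖ ^ 2) := by
  rw [norm_sq_H1]
  refine ((hasSum_cf_sq (D 0 u)).add (hasSum_cf_D1 u)).congr_fun fun κ => ?_
  rw [lam, co_apply]
  ring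

theorem sum_lam_co_sq_le {m : ℕ} (u : Hper m 1) (s : Finset (ℤ × Fin m)) :
    ∑ κ ∈ s, lam κ * co κ u ^ 2 ≤ ‖u‖ ^ 2 :=
  sum_le_hasSum s (fun κ _ => mul_nonneg (lam_pos κ).le (sq_nonneg _)) (hasSum_norm_H1 u)

theorem norm_D0_le {m : ℕ} (u : Hper m 1) : ‖D 0 u‖ ≤ ‖u‖ := by
  refine abs_le_of_sq_le_sq' ?_ (norm_nonneg _) |>.2
  rw [norm_sq_H1]
  nlinarith [sq_nonneg ‖D 1 u‖]

theorem norm_D1_le {m : ℕ} (u : Hper m 1) : ‖D 1 u‖ ≤ ‖u‖ := by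
  refine abs_le_of_sq_le_sq' ?_ (norm_nonneg _) |>.2
  rw [norm_sq_H1]
  nlinarith [sq_nonneg ‖D 0 u‖]

theorem cf_D2 {m : ℕ} (U : Hper m 2) (κ : ℤ × Fin m) :
    cf κ (D 2 U) = -(κ.1 : ℝ) ^ 2 * cf κ (D 0 U) := by
  have h1 := cf_D_succ U 1 κ
  have h0 := cf_D_succ U 0 (refl m κ)
  rw [refl_refl, refl_fst] at h0
  change cf κ (D 2 U) = -κ.1 * cf (refl m κ) (D 1 U) at h1
  change cf (refl m κ) (D 1 U) = -(-κ.1 : ℤ) * cf κ (D 0 U) at h0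
  rw [h1, h0]
  push_cast
  ring

theorem D0_toH1 {m : ℕ} (U : Hper m 2) : D 0 (toH1 U) = D 0 U := rfl

theorem D1_toH1 {m : ℕ} (U : Hper m 2) : D 1 (toH1 U) = D 1 U := rfl

theorem hasSum_norm_H2 {m : ℕ} (U : Hper m 2) :
    HasSum (fun κ => (lam κ + (κ.1 : ℝ) ^ 4) * co κ (toH1 U) ^ 2) (‖U‖ ^ 2) := by
  have e : ‖U‖ ^ 2 = ‖toH1 U‖ ^ 2 + ‖D 2 U‖ ^ 2 := by
    rw [norm_sq_Hper, Fin.sum_univ_three, norm_sq_H1, D0_toH1, D1_toH1]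
  rw [e]
  refine ((hasSum_norm_H1 (toH1 U)).add (hasSum_cf_sq (D 2 U))).congr_fun fun κ => ?_
  rw [cf_D2, co_apply, D0_toH1]
  ring

theorem ext_co {m : ℕ} {u v : Hper m 1} (h : ∀ κ, co κ u = co κ v) : u = v := by
  rw [← sub_eq_zero, ← norm_eq_zero, ← sq_eq_zero_iff]
  refine (hasSum_norm_H1 (u - v)).unique (hasSum_zero.congr_fun fun κ => ?_)
  simp [h κ]

/-- The weight `(1 + n²)²` dominates `1`, `n²` and `n⁴`, so all three candidate derivatives have
square summable coefficients. -/
theorem exists_H2_of_summable {m : ℕ} {c : ℤ × Fin m → ℝ}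
    (hc : Summable fun κ => (lam κ * c κ) ^ 2) : ∃ U : Hper m 2, ∀ κ, co κ (toH1 U) = c κ := by
  obtain ⟨d0, h0⟩ := exists_cf_eq (c := c) (hc.of_nonneg_of_le (fun _ => sq_nonneg _) fun κ => by
    rw [mul_pow]
    exact le_mul_of_one_le_left (sq_nonneg _) (one_le_pow₀ (one_le_lam κ)))
  obtain ⟨d1, h1⟩ := exists_cf_eq (c := fun κ => -κ.1 * c (refl m κ)) (by
    rw [← (refl m).summable_iff]
    refine hc.of_nonneg_of_le (fun _ => sq_nonneg _) fun κ => ?_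
    simp only [Function.comp_apply, refl_refl, refl_fst, lam, mul_pow]
    push_cast
    nlinarith [sq_nonneg (c κ), sq_nonneg (κ.1 : ℝ), sq_nonneg ((κ.1 : ℝ) * c κ),
      sq_nonneg ((κ.1 : ℝ) ^ 2 * c κ)])
  obtain ⟨d2, h2⟩ := exists_cf_eq (c := fun κ => -(κ.1 : ℝ) ^ 2 * c κ) (by
    refine hc.of_nonneg_of_le (fun _ => sq_nonneg _) fun κ => ?_
    simp only [lam, mul_pow]
    nlinarith [sq_nonneg (c κ), sq_nonneg (κ.1 : ℝ), sq_nonneg ((κ.1 : ℝ) * c κ),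
      sq_nonneg ((κ.1 : ℝ) ^ 2 * c κ)])
  refine ⟨⟨WithLp.toLp 2 ![d0, d1, d2], fun i => isPerWeakDeriv_of_cf fun κ => ?_⟩, fun κ => h0 κ⟩
  fin_cases i
  · change cf κ d1 = -κ.1 * cf (refl m κ) d0
    rw [h1, h0]
  · change cf κ d2 = -κ.1 * cf (refl m κ) d1
    rw [h2, h1, refl_refl, refl_fst]
    push_cast
    ring

theorem exists_H1_of_summable {m : ℕ} {c : ℤ × Fin m → ℝ}
    (hc : Summable fun κ => lam κ * c κ ^ 2) : ∃ u : Hper m 1, ∀ κ, co κ u = c κ := by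
  obtain ⟨d0, h0⟩ := exists_cf_eq (c := c) (hc.of_nonneg_of_le (fun _ => sq_nonneg _) fun κ => by
    nlinarith [one_le_lam κ, sq_nonneg (c κ)])
  obtain ⟨d1, h1⟩ := exists_cf_eq (c := fun κ => -κ.1 * c (refl m κ)) (by
    rw [← (refl m).summable_iff]
    refine hc.of_nonneg_of_le (fun _ => sq_nonneg _) fun κ => ?_
    simp only [Function.comp_apply, refl_refl, refl_fst, lam]
    push_cast
    nlinarith [sq_nonneg (c κ)])
  refine ⟨⟨WithLp.toLp 2 ![d0, d1], fun i => isPerWeakDeriv_of_cf fun κ => ?_⟩, fun κ => h0 κ⟩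
  fin_cases i
  change cf κ d1 = -κ.1 * cf (refl m κ) d0
  rw [h1, h0]

/-- A family in `H¹` with continuous Fourier coefficients and uniformly summable squares is
continuous. -/
theorem continuousOn_of_co {m : ℕ} {X : Type*} [TopologicalSpace X] {s : Set X}
    {u : X → Hper m 1} {M : ℤ × Fin m → ℝ} (hM : Summable M)
    (hc : ∀ κ, ContinuousOn (fun x => co κ (u x)) s)
    (hb : ∀ x ∈ s, ∀ κ, lam κ * co κ (u x) ^ 2 ≤ M κ) : ContinuousOn u s := by
  intro x hx
  have h1 : Tendsto (fun y => ∑' κ, lam κ * co κ (u y - u x) ^ 2) (𝓝[s] x)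
      (𝓝 (∑' _ : ℤ × Fin m, (0 : ℝ))) := by
    refine tendsto_tsum_of_dominated_convergence (bound := fun κ => 4 * M κ) (hM.mul_left 4) ?_ ?_
    · intro κ
      have := (((hc κ x hx).tendsto.sub_const (co κ (u x))).pow 2).const_mul (lam κ)
      simpa using this
    · filter_upwards [self_mem_nhdsWithin] with y hy κ
      rw [Real.norm_of_nonneg (mul_nonneg (lam_pos κ).le (sq_nonneg _)), map_sub]
      nlinarith [hb x hx κ, hb y hy κ, lam_pos κ,
        mul_nonneg (lam_pos κ).le (sq_nonneg (co κ (u y) + co κ (u x)))]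
  simp only [(hasSum_norm_H1 _).tsum_eq, tsum_zero] at h1
  rw [ContinuousWithinAt, tendsto_iff_norm_sub_tendsto_zero]
  simpa using h1.sqrt

/-! ### The embedding of `H¹` into `L^∞` -/

theorem abs_cas_le (n : ℤ) (x : ℝ) : |cas n x| ≤ 1 := by
  simp only [cas, ContinuousMap.coe_mk]
  have h2 : (2 : ℝ) ≤ √(2 * Real.pi) := by
    refine Real.le_sqrt_of_sq_le ?_
    nlinarith [Real.pi_gt_three]
  have h3 : |Real.cos (n * x) + Real.sin (n * x)| ≤ 2 :=
    (abs_add_le _ _).trans (by linarith [Real.abs_cos_le_one (n * x), Real.abs_sin_le_one (n * x)])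
  rw [abs_mul, abs_of_pos (by positivity), inv_mul_le_iff₀ (by positivity)]
  linarith

theorem ae_norm_sum_trig_le {m : ℕ} (c : ℤ × Fin m → ℝ) (s : Finset (ℤ × Fin m)) :
    ∀ᵐ x ∂μ, ‖(∑ κ ∈ s, c κ • trig κ : L2 m) x‖ ≤ ∑ κ ∈ s, |c κ| := by
  classical
  induction s using Finset.induction_on with
  | empty =>
    filter_upwards [Lp.coeFn_zero (E m) 2 μ] with x hx
    rw [Finset.sum_empty, Finset.sum_empty, hx, Pi.zero_apply, norm_zero]
  | insert κ s hκ ih =>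
    rw [Finset.sum_insert hκ, Finset.sum_insert hκ]
    filter_upwards [ih, Lp.coeFn_add (c κ • trig κ) (∑ κ ∈ s, c κ • trig κ : L2 m),
      Lp.coeFn_smul (c κ) (trig κ : L2 m),
      coeFn_sm (cas κ.1) (EuclideanSpace.single κ.2 (1 : ℝ))] with x h1 h2 h3 h4
    rw [h2, Pi.add_apply, h3, Pi.smul_apply, trig, h4]
    refine (norm_add_le _ _).trans (add_le_add ?_ h1)
    rw [norm_smul, norm_smul, PiLp.norm_single, norm_one, mul_one, Real.norm_eq_abs]
    exact mul_le_of_le_one_right (abs_nonneg _) (abs_cas_le _ _)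

theorem summable_inv_lam (m : ℕ) : Summable fun κ : ℤ × Fin m => (lam κ)⁻¹ := by
  have h1 : Summable fun n : ℤ => (1 + (n : ℝ) ^ 2)⁻¹ := by
    refine Summable.of_norm_bounded_eventually (Real.summable_one_div_int_pow.2 one_lt_two) ?_
    filter_upwards [(Set.finite_singleton (0 : ℤ)).compl_mem_cofinite] with n hn
    have hn' : (n : ℝ) ≠ 0 := by simpa using hn
    rw [Real.norm_of_nonneg (by positivity), one_div]
    exact inv_anti₀ (by positivity) (by linarith)
  have h2 : Summable fun _ : Fin m => (1 : ℝ) := Summable.of_finite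
  simpa [lam] using h1.mul_of_nonneg h2 (fun n => by positivity) (fun _ => zero_le_one)

/-- The embedding of `H¹` into `L^∞`. -/
theorem exists_sup_bound (m : ℕ) :
    ∃ C : ℝ, 0 ≤ C ∧ ∀ u : Hper m 1, ∀ᵐ x ∂μ, ‖D 0 u x‖ ≤ C * ‖u‖ := by
  refine ⟨√(∑' κ : ℤ × Fin m, (lam κ)⁻¹), Real.sqrt_nonneg _, fun u => ?_⟩
  -- Cauchy–Schwarz with weights `(lam κ)⁻¹` and `lam κ`; summability of the former is where one
  -- space dimension enters.
  have hb : ∀ s : Finset (ℤ × Fin m), ∑ κ ∈ s, |co κ u| ≤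
      √(∑' κ : ℤ × Fin m, (lam κ)⁻¹) * ‖u‖ := by
    intro s
    rw [← Real.sqrt_sq (norm_nonneg u), ← Real.sqrt_mul (tsum_nonneg fun κ =>
      (inv_pos.2 (lam_pos κ)).le)]
    refine Real.le_sqrt_of_sq_le ?_
    refine (Finset.sum_sq_le_sum_mul_sum_of_sq_le_mul s
      (f := fun κ : ℤ × Fin m => (lam κ)⁻¹) (g := fun κ => lam κ * co κ u ^ 2)
      (fun κ _ => (inv_pos.2 (lam_pos κ)).le)
      (fun κ _ => mul_nonneg (lam_pos κ).le (sq_nonneg _)) fun κ _ => ?_).trans ?_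
    · rw [sq_abs, inv_mul_cancel_left₀ (lam_pos κ).ne']
    · refine mul_le_mul ?_ (sum_lam_co_sq_le u s) (Finset.sum_nonneg fun κ _ =>
        mul_nonneg (lam_pos κ).le (sq_nonneg _)) (tsum_nonneg fun κ => (inv_pos.2 (lam_pos κ)).le)
      exact (summable_inv_lam m).sum_le_tsum s fun κ _ => (inv_pos.2 (lam_pos κ)).le
  have hlim : Tendsto (fun s : Finset (ℤ × Fin m) => ∑ κ ∈ s, co κ u • (trig κ : L2 m)) atTop
    (𝓝 (D 0 u)) := hasSum_cf_smul (D 0 u)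
  -- Convergence in `L²` is pointwise a.e. only along a subsequence, which is enough to pass the
  -- uniform bound to the limit.
  obtain ⟨ns, -, hns⟩ := (tendstoInMeasure_of_tendsto_Lp hlim).exists_seq_tendsto_ae'
  have hall : ∀ᵐ x ∂μ, ∀ n, ‖(∑ κ ∈ ns n, co κ u • trig κ : L2 m) x‖ ≤ ∑ κ ∈ ns n, |co κ u| :=
    ae_all_iff.2 fun n => ae_norm_sum_trig_le _ _
  filter_upwards [hns, hall] with x h1 h2
  exact le_of_tendsto h1.norm (Eventually.of_forall fun n => (h2 n).trans (hb _))

/-! ### Dini derivatives and differential inequalities -/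

/-- `c` is an upper bound for the upper right Dini derivative of `y` at `t`. -/
def UpperSlope (y : ℝ → ℝ) (t c : ℝ) : Prop := ∀ r, c < r → ∀ᶠ z in 𝓝[>] t, slope y t z < r

theorem UpperSlope.add {y z : ℝ → ℝ} {t c d : ℝ} (hy : UpperSlope y t c) (hz : UpperSlope z t d) :
    UpperSlope (fun s => y s + z s) t (c + d) := by
  intro r hr
  filter_upwards [hy (c + (r - c - d) / 2) (by linarith),
    hz (d + (r - c - d) / 2) (by linarith)] with s h1 h2
  have : slope (fun s => y s + z s) t s = slope y t s + slope z t s := by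
    simp only [slope_def_field]
    ring
  rw [this]
  linarith

theorem UpperSlope.mono {y : ℝ → ℝ} {t c d : ℝ} (hy : UpperSlope y t c) (h : c ≤ d) :
    UpperSlope y t d := fun r hr => hy r (h.trans_lt hr)

theorem UpperSlope.of_hasDerivWithinAt {y : ℝ → ℝ} {t c : ℝ}
    (h : HasDerivWithinAt y c (Ioi t) t) : UpperSlope y t c := by
  intro r hr
  have h1 := hasDerivWithinAt_iff_tendsto_slope.1 h
  rw [sdiff_singleton_eq_self (by simp)] at h1
  exact h1.eventually (gt_mem_nhds hr)

theorem le_gronwallBound_of_upperSlope {y : ℝ → ℝ} {a b K ε : ℝ} (hy : ContinuousOn y (Icc a b))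
    (h : ∀ t ∈ Ico a b, UpperSlope y t (K * y t + ε)) {t : ℝ} (ht : t ∈ Icc a b) :
    y t ≤ gronwallBound (y a) K ε (t - a) := by
  refine le_gronwallBound_of_liminf_deriv_right_le (f' := fun t => K * y t + ε) hy ?_ le_rfl
    (fun _ _ => le_rfl) t ht
  intro x hx r hr
  refine (h x hx r hr).frequently.mono fun z hz => ?_
  rwa [slope_def_field, div_eq_inv_mul] at hz

theorem le_of_upperSlope {y B B' : ℝ → ℝ} {a b : ℝ} (hy : ContinuousOn y (Icc a b))
    (h : ∀ t ∈ Ico a b, UpperSlope y t (B' t)) (ha : y a ≤ B a)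
    (hB : ∀ t, HasDerivAt B (B' t) t) {t : ℝ} (ht : t ∈ Icc a b) : y t ≤ B t :=
  image_le_of_liminf_slope_right_le_deriv_boundary hy ha
    (fun t _ => (hB t).continuousAt.continuousWithinAt) (fun t _ => (hB t).hasDerivWithinAt)
    (fun x hx r hr => (h x hx r hr).frequently) ht

/-! ### The linear parabolic problem: energy estimates -/

/-- `u ∈ C([0,T]; H¹)` solves `∂ₜu - ∂ₓ²u + u = h` with `h ∈ C([0,T]; L²)`, in the sense that
every Fourier coefficient solves the corresponding ordinary differential equation. -/
structure IsMild {m : ℕ} (T : ℝ) (h : ℝ → L2 m) (u : ℝ → Hper m 1) : Prop where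
  cont_h : ContinuousOn h (Icc 0 T)
  cont_u : ContinuousOn u (Icc 0 T)
  hasDeriv : ∀ κ, ∀ t ∈ Icc 0 T, HasDerivWithinAt (fun s => co κ (u s))
    (-lam κ * co κ (u t) + cf κ (h t)) (Icc 0 T) t

section

variable {m : ℕ} {T : ℝ} {h h' : ℝ → L2 m} {u u' : ℝ → Hper m 1}

theorem IsMild.sub (hu : IsMild T h u) (hu' : IsMild T h' u') :
    IsMild T (fun t => h t - h' t) (fun t => u t - u' t) where
  cont_h := hu.cont_h.sub hu'.cont_h
  cont_u := hu.cont_u.sub hu'.cont_u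
  hasDeriv κ t ht := by
    simp only [map_sub]
    convert! (hu.hasDeriv κ t ht).sub (hu'.hasDeriv κ t ht) using 1
    ring

theorem IsMild.shift (hu : IsMild T h u) {s T' : ℝ} (hs : 0 ≤ s) (hT : T' + s ≤ T) :
    IsMild T' (fun t => h (t + s)) (fun t => u (t + s)) := by
  have hmaps : MapsTo (fun t => t + s) (Icc 0 T') (Icc 0 T) := fun t ht =>
    ⟨by linarith [ht.1], by linarith [ht.2]⟩
  have hc : ContinuousOn (fun t : ℝ => t + s) (Icc 0 T') := by fun_prop
  refine ⟨hu.cont_h.comp hc hmaps, hu.cont_u.comp hc hmaps, fun κ t ht => ?_⟩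
  have := (hu.hasDeriv κ _ (hmaps ht)).comp t ((hasDerivWithinAt_id t _).add_const s) hmaps
  simpa [Function.comp_def] using this

theorem IsMild.mono (hu : IsMild T h u) {T' : ℝ} (hT : T' ≤ T) : IsMild T' h u := by
  simpa using hu.shift le_rfl (T' := T') (by simpa using hT)

theorem IsMild.congr (hu : IsMild T h u) (hh : EqOn h' h (Icc 0 T)) (huu : EqOn u' u (Icc 0 T)) :
    IsMild T h' u' := by
  refine ⟨hu.cont_h.congr hh, hu.cont_u.congr huu, fun κ t ht => ?_⟩
  rw [huu ht, hh ht]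
  exact (hu.hasDeriv κ t ht).congr (fun s hs => by rw [huu hs]) (by rw [huu ht])

/-- The basic parabolic estimate on a short time interval. -/
theorem IsMild.step (hu : IsMild T h u) {s t b : ℝ} (hs : 0 ≤ s) (hst : s ≤ t) (ht : t ≤ T)
    (hb : ∀ r ∈ Icc s t, ‖h r‖ ≤ b) :
    ‖D 0 (u t - u s)‖ ^ 2 + (t - s) * ‖u t‖ ^ 2 ≤ (t - s) * (‖u s‖ ^ 2 + (t - s) * b ^ 2) := by
  rcases hst.eq_or_lt with rfl | hlt
  · simp [← DL_apply]
  have hsub : Icc s t ⊆ Icc 0 T := Icc_subset_Icc hs ht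
  have hF : ∀ F : Finset (ℤ × Fin m), ∑ κ ∈ F, cf κ (D 0 (u t - u s)) ^ 2 +
      (t - s) * ∑ κ ∈ F, lam κ * co κ (u t) ^ 2 ≤ (t - s) * (‖u s‖ ^ 2 + (t - s) * b ^ 2) := by
    intro F
    -- `c κ` is the mean rate of change on `[s, t]`. The inequality `2 c a' - c² ≤ a'²`, where `a'`
    -- is the derivative of the coefficient, replaces Cauchy–Schwarz for `∫ a'²`, so `ψ` needs only
    -- a pointwise bound on its derivative.
    let c : ℤ × Fin m → ℝ := fun κ => co κ (u t - u s) / (t - s)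
    let ψ : ℝ → ℝ := fun r => ∑ κ ∈ F,
      (2 * c κ * co κ (u r) - c κ ^ 2 * r + lam κ * co κ (u r) ^ 2)
    let ψ' : ℝ → ℝ := fun r => ∑ κ ∈ F, (2 * c κ * (-lam κ * co κ (u r) + cf κ (h r)) - c κ ^ 2 +
      lam κ * (2 * co κ (u r) * (-lam κ * co κ (u r) + cf κ (h r))))
    have hd : ∀ r ∈ Icc s t, HasDerivWithinAt ψ (ψ' r) (Icc 0 T) r := by
      intro r hr
      refine HasDerivWithinAt.fun_sum fun κ _ => ?_
      have h1 := hu.hasDeriv κ r (hsub hr)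
      have h2 := ((hasDerivWithinAt_id r (Icc 0 T)).const_mul (c κ ^ 2))
      convert! ((h1.const_mul (2 * c κ)).sub h2).add ((h1.pow 2).const_mul (lam κ)) using 1
      simp
    have hle : ∀ r ∈ Icc s t, ψ' r ≤ b ^ 2 := by
      intro r hr
      calc ψ' r ≤ ∑ κ ∈ F, cf κ (h r) ^ 2 := by
            -- With `a' = -λa + h` one has `a'² + 2λaa' = h² - (λa)² ≤ h²`.
            refine Finset.sum_le_sum fun κ _ => ?_
            nlinarith [sq_nonneg (-lam κ * co κ (u r) + cf κ (h r) - c κ),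
              sq_nonneg (lam κ * co κ (u r))]
        _ ≤ ‖h r‖ ^ 2 := sum_cf_sq_le _ _
        _ ≤ b ^ 2 := by
            have := hb r hr
            gcongr
    have hmv : ψ t ≤ ψ s + b ^ 2 * (t - s) := by
      refine image_le_of_deriv_right_le_deriv_boundary (f := ψ) (f' := ψ') (a := s) (b := t)
        (B := fun r => ψ s + b ^ 2 * (r - s)) (B' := fun _ => b ^ 2) ?_ ?_ (by simp) (by fun_prop)
        ?_ (fun r hr => hle r (Ico_subset_Icc_self hr)) ⟨hst, le_rfl⟩
      · exact fun r hr => ((hd r hr).continuousWithinAt).mono hsub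
      · intro r hr
        exact (hd r (Ico_subset_Icc_self hr)).mono_of_mem_nhdsWithin
          (Icc_mem_nhdsGE_of_mem ⟨hs.trans hr.1, hr.2.trans_le ht⟩)
      · intro r _
        simpa using (((hasDerivAt_id r).sub_const s).const_mul (b ^ 2)).const_add (ψ s)
          |>.hasDerivWithinAt
    have hpos : 0 < t - s := sub_pos.2 hlt
    have hψ : (t - s) * (ψ t - ψ s) = ∑ κ ∈ F, (cf κ (D 0 (u t - u s)) ^ 2 +
        (t - s) * (lam κ * co κ (u t) ^ 2 - lam κ * co κ (u s) ^ 2)) := by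
      simp only [ψ, ← Finset.sum_sub_distrib, Finset.mul_sum]
      refine Finset.sum_congr rfl fun κ _ => ?_
      rw [← co_apply]
      simp only [c, map_sub]
      field_simp
      ring
    rw [Finset.sum_add_distrib, ← Finset.mul_sum, Finset.sum_sub_distrib] at hψ
    have := sum_lam_co_sq_le (u s) F
    nlinarith
  have h1 := hasSum_cf_sq (D 0 (u t - u s))
  have h2 := (hasSum_norm_H1 (u t)).mul_left (t - s)
  refine le_of_tendsto (h1.add h2) (Eventually.of_forall fun F => ?_)
  rw [Finset.sum_add_distrib, ← Finset.mul_sum]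
  exact hF F

/-- Drop the increment in `IsMild.step` and divide by the length of the interval. A one-sided slope
bound suffices for Gronwall and avoids differentiability of the squared `H¹` norm. -/
theorem IsMild.upperSlope_norm_sq (hu : IsMild T h u) {t : ℝ} (ht : t ∈ Ico 0 T) :
    UpperSlope (fun s => ‖u s‖ ^ 2) t (‖h t‖ ^ 2) := by
  intro r hr
  have hr0 : 0 ≤ r := (sq_nonneg _).trans hr.le
  have hr' : ‖h t‖ < √r := Real.lt_sqrt_of_sq_lt hr
  -- By continuity `‖h‖` stays below `b` just after `t`; the slope is then at most `b² < r`.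
  obtain ⟨b, hb1, hb2⟩ := exists_between hr'
  have hb0 : 0 ≤ b := (norm_nonneg _).trans hb1.le
  have hcont : ContinuousWithinAt (fun s => ‖h s‖) (Ici t) t :=
    ((hu.cont_h t (Ico_subset_Icc_self ht)).norm).mono_of_mem_nhdsWithin
      (Icc_mem_nhdsGE_of_mem ht)
  have hev := hcont.eventually (gt_mem_nhds hb1)
  obtain ⟨z₀, hz₀, hz⟩ := mem_nhdsGE_iff_exists_Icc_subset.1 hev
  filter_upwards [Ioc_mem_nhdsGT (lt_min (mem_Ioi.1 hz₀) ht.2)] with z hzm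
  have hzt : 0 < z - t := sub_pos.2 hzm.1
  have := hu.step ht.1 hzm.1.le (hzm.2.trans (min_le_right _ _)) (b := b) fun q hq =>
    (hz ⟨hq.1, hq.2.trans (hzm.2.trans (min_le_left _ _))⟩ : ‖h q‖ < b).le
  have h2 : (z - t) * (‖u z‖ ^ 2) ≤ (z - t) * (‖u t‖ ^ 2 + (z - t) * b ^ 2) := by
    nlinarith [sq_nonneg ‖D 0 (u z - u t)‖]
  have h3 := le_of_mul_le_mul_left h2 hzt
  rw [slope_def_field, div_lt_iff₀ hzt]
  have h4 : b ^ 2 < r := by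
    have := pow_lt_pow_left₀ hb2 hb0 two_ne_zero
    rwa [Real.sq_sqrt hr0] at this
  nlinarith

/-- A majorant independent of `F`, used for dominated convergence of the partial energy sums. -/
theorem abs_sum_energy_le (F : Finset (ℤ × Fin m)) (v : Hper m 1) (g : L2 m) :
    |∑ κ ∈ F, 2 * co κ v * (-lam κ * co κ v + cf κ g)| ≤ 3 * ‖v‖ ^ 2 + ‖g‖ ^ 2 := by
  have h1 := sum_lam_co_sq_le v F
  have h2 := sum_cf_sq_le g F
  refine (Finset.abs_sum_le_sum_abs _ _).trans ?_
  calc _ ≤ ∑ κ ∈ F, (3 * (lam κ * co κ v ^ 2) + cf κ g ^ 2) := by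
        refine Finset.sum_le_sum fun κ _ => abs_le.2 ⟨?_, ?_⟩ <;>
        nlinarith [sq_nonneg (co κ v + cf κ g), sq_nonneg (co κ v - cf κ g), one_le_lam κ,
          sq_nonneg (co κ v), mul_nonneg (sub_nonneg.2 (one_le_lam κ)) (sq_nonneg (co κ v))]
    _ ≤ _ := by
        rw [Finset.sum_add_distrib, ← Finset.mul_sum]
        linarith

/-- The energy identity. -/
theorem IsMild.upperSlope_norm_D0_sq (hu : IsMild T h u) {t : ℝ} (ht : t ∈ Ico 0 T) :
    UpperSlope (fun s => ‖D 0 (u s)‖ ^ 2) t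
      (2 * (-‖u t‖ ^ 2 + inner ℝ (h t) (D 0 (u t)))) := by
  have hT : 0 ≤ T := ht.1.trans ht.2.le
  let R : ℝ → ℝ := fun s => 2 * (-‖u s‖ ^ 2 + inner ℝ (h s) (D 0 (u s)))
  have hRc : ContinuousOn R (Icc 0 T) := by
    have h1 : ContinuousOn (fun s => D 0 (u s)) (Icc 0 T) :=
      (DL 0).continuous.comp_continuousOn hu.cont_u
    exact ((hu.cont_u.norm.pow 2).neg.add (hu.cont_h.inner h1)).const_smul (2 : ℝ)
  have hR : ∀ s, HasSum (fun κ => 2 * co κ (u s) * (-lam κ * co κ (u s) + cf κ (h s))) (R s) := by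
    intro s
    refine (((hasSum_norm_H1 (u s)).neg.add
      (hasSum_cf_mul_cf (h s) (D 0 (u s)))).mul_left 2).congr_fun fun κ => ?_
    rw [← co_apply]
    ring
  -- The energy identity is proved in integrated form: it holds for each mode, and both sides
  -- converge as the finite set of modes grows. Continuity of `R` then allows differentiation.
  have hint : ∀ r ∈ Icc 0 T, ∫ s in (0 : ℝ)..r, R s = ‖D 0 (u r)‖ ^ 2 - ‖D 0 (u 0)‖ ^ 2 := by
    intro r hr
    have hsub : Icc 0 r ⊆ Icc 0 T := Icc_subset_Icc le_rfl hr.2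
    have hcc : ∀ κ, ContinuousOn (fun s => 2 * co κ (u s) * (-lam κ * co κ (u s) + cf κ (h s)))
        (Icc 0 r) := by
      intro κ
      have h1 := (co κ).continuous.comp_continuousOn (hu.cont_u.mono hsub)
      have h2 := (cf κ).continuous.comp_continuousOn (hu.cont_h.mono hsub)
      exact (h1.const_smul (2 : ℝ)).mul ((h1.const_smul (-lam κ)).add h2)
    have h1 : Tendsto (fun F : Finset (ℤ × Fin m) => ∫ s in (0 : ℝ)..r,
        ∑ κ ∈ F, 2 * co κ (u s) * (-lam κ * co κ (u s) + cf κ (h s))) atTop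
        (𝓝 (∫ s in (0 : ℝ)..r, R s)) := by
      refine intervalIntegral.tendsto_integral_filter_of_dominated_convergence
        (fun s => 3 * ‖u s‖ ^ 2 + ‖h s‖ ^ 2) (Eventually.of_forall fun F => ?_)
        (Eventually.of_forall fun F => ae_of_all _ fun s _ => abs_sum_energy_le F (u s) (h s))
        ?_ (ae_of_all _ fun s _ => hR s)
      · rw [uIoc_of_le hr.1]
        exact ((continuousOn_finsetSum F fun κ _ => hcc κ).mono
          Ioc_subset_Icc_self).aestronglyMeasurable measurableSet_Ioc
      · refine ContinuousOn.intervalIntegrable ?_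
        rw [uIcc_of_le hr.1]
        have h1 := hu.cont_u.mono hsub
        have h2 := hu.cont_h.mono hsub
        fun_prop
    have h2 : Tendsto (fun F : Finset (ℤ × Fin m) => ∫ s in (0 : ℝ)..r,
        ∑ κ ∈ F, 2 * co κ (u s) * (-lam κ * co κ (u s) + cf κ (h s))) atTop
        (𝓝 (‖D 0 (u r)‖ ^ 2 - ‖D 0 (u 0)‖ ^ 2)) := by
      refine ((hasSum_cf_sq (D 0 (u r))).sub (hasSum_cf_sq (D 0 (u 0)))).congr fun F => ?_
      rw [intervalIntegral.integral_finsetSum fun κ _ => ?_]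
      · refine Finset.sum_congr rfl fun κ _ => ?_
        have hd : ∀ s ∈ Icc 0 r, HasDerivWithinAt (fun s => co κ (u s) ^ 2)
            (2 * co κ (u s) * (-lam κ * co κ (u s) + cf κ (h s))) (Icc 0 r) s := by
          intro s hs
          convert! ((hu.hasDeriv κ s (hsub hs)).mono hsub).pow 2 using 1
          simp
        rw [intervalIntegral.integral_eq_sub_of_hasDeriv_right_of_le hr.1
          (fun s hs => (hd s hs).continuousWithinAt) (fun s hs =>
            (hd s (Ioo_subset_Icc_self hs)).mono_of_mem_nhdsWithin
              (Icc_mem_nhdsGT_of_mem (Ioo_subset_Ico_self hs)))]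
        · rfl
        · exact ContinuousOn.intervalIntegrable (by rw [uIcc_of_le hr.1]; exact hcc κ)
      · exact ContinuousOn.intervalIntegrable (by rw [uIcc_of_le hr.1]; exact hcc κ)
    exact tendsto_nhds_unique h1 h2
  have hder : HasDerivWithinAt (fun r => ∫ s in (0 : ℝ)..r, R s) (R t) (Ici t) t := by
    refine intervalIntegral.integral_hasDerivWithinAt_right (t := Ioi t) ?_ ?_ ?_
    · refine (hRc.mono ?_).intervalIntegrable
      rw [uIcc_of_le ht.1]
      exact Icc_subset_Icc le_rfl ht.2.le
    · exact (hRc.stronglyMeasurableAtFilter_nhdsWithin measurableSet_Icc t).filter_mono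
        (nhdsWithin_le_of_mem (Icc_mem_nhdsGT_of_mem ht))
    · exact (hRc t (Ico_subset_Icc_self ht)).mono_of_mem_nhdsWithin (Icc_mem_nhdsGT_of_mem ht)
  refine UpperSlope.of_hasDerivWithinAt ?_
  have h3 : HasDerivWithinAt (fun r => (∫ s in (0 : ℝ)..r, R s) + ‖D 0 (u 0)‖ ^ 2) (R t)
      (Icc t T) t := (hder.mono Icc_subset_Ici_self).add_const _
  refine HasDerivWithinAt.mono_of_mem_nhdsWithin (t := Icc t T) ?_
    (Icc_mem_nhdsGT_of_mem ⟨le_rfl, ht.2⟩)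
  refine h3.congr (fun r hr => ?_) ?_
  · rw [hint r ⟨ht.1.trans hr.1, hr.2⟩]; ring
  · rw [hint t (Ico_subset_Icc_self ht)]; ring

end

/-! ### The nonlinearity as a map from `H¹` to `L²` -/

/-- The properties of the nonlinearity that are used: boundedness, Lipschitz continuity and decay
at infinity. -/
structure IsTame {m : ℕ} (f : E m → (E m →L[ℝ] E m)) (g : E m → E m) (K : ℝ) : Prop where
  nonneg : 0 ≤ K
  cont_f : Continuous f
  cont_g : Continuous g
  f_le : ∀ y, ‖f y‖ ≤ K
  g_le : ∀ y, ‖g y‖ ≤ K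
  f_lip : ∀ y z, ‖f y - f z‖ ≤ K * ‖y - z‖
  g_lip : ∀ y z, ‖g y - g z‖ ≤ K * ‖y - z‖
  f_decay : ∀ y, ‖f y‖ * ‖y‖ ≤ K
  g_decay : ∀ y, ‖g y‖ * ‖y‖ ≤ K

theorem exists_bounds {m : ℕ} {G : Type*} [NormedAddCommGroup G] [NormedSpace ℝ G] {f : E m → G}
    (hf : ContDiff ℝ ∞ f) (hs : HasCompactSupport f) :
    ∃ K, 0 ≤ K ∧ (∀ y, ‖f y‖ ≤ K) ∧ (∀ y z, ‖f y - f z‖ ≤ K * ‖y - z‖) ∧ ∀ y, ‖f y‖ * ‖y‖ ≤ K := by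
  obtain ⟨C₁, h₁⟩ := hs.exists_bound_of_continuous hf.continuous
  obtain ⟨C₂, h₂⟩ := ContDiff.lipschitzWith_of_hasCompactSupport hs hf (by norm_num)
  obtain ⟨C₃, h₃⟩ := (hs.smul_left (f := fun y : E m => ‖y‖)).exists_bound_of_continuous
    (continuous_norm.smul hf.continuous)
  have h0 : 0 ≤ C₁ := (norm_nonneg _).trans (h₁ 0)
  have h0' : 0 ≤ C₃ := (norm_nonneg _).trans (h₃ 0)
  have h0'' : (0 : ℝ) ≤ C₂ := C₂.2
  refine ⟨C₁ + C₂ + C₃, by positivity, fun y => (h₁ y).trans (by linarith), fun y z => ?_,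
    fun y => ?_⟩
  · have := h₂.dist_le_mul y z
    rw [dist_eq_norm, dist_eq_norm] at this
    refine this.trans (mul_le_mul_of_nonneg_right (by linarith) (norm_nonneg _))
  · have := h₃ y
    simp only [Pi.smul_apply', norm_smul, norm_norm] at this
    linarith [mul_comm ‖f y‖ ‖y‖]

theorem exists_isTame {m : ℕ} {f : E m → (E m →L[ℝ] E m)} {g : E m → E m}
    (hf : ContDiff ℝ ∞ f) (hf_supp : HasCompactSupport f) (hg : ContDiff ℝ ∞ g)
    (hg_supp : HasCompactSupport g) : ∃ K, IsTame f g K := by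
  obtain ⟨A, hA, h1, h2, h3⟩ := exists_bounds hf hf_supp
  obtain ⟨B, hB, k1, k2, k3⟩ := exists_bounds hg hg_supp
  have hA' : A ≤ A + B := by linarith
  have hB' : B ≤ A + B := by linarith
  exact ⟨A + B, by positivity, hf.continuous, hg.continuous, fun y => (h1 y).trans hA',
    fun y => (k1 y).trans hB',
    fun y z => (h2 y z).trans (mul_le_mul_of_nonneg_right hA' (norm_nonneg _)),
    fun y z => (k2 y z).trans (mul_le_mul_of_nonneg_right hB' (norm_nonneg _)),
    fun y => (h3 y).trans hA', fun y => (k3 y).trans hB'⟩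

open Classical in
/-- The nonlinearity `-f(u) ∂ₓu - g(u)` as an element of `L²`. -/
def nonlin {m : ℕ} (f : E m → (E m →L[ℝ] E m)) (g : E m → E m) (u : Hper m 1) : L2 m :=
  if h : MemLp (fun x => -f (D 0 u x) (D 1 u x) - g (D 0 u x)) 2 μ then h.toLp else 0

theorem integrable_norm_sq {m : ℕ} (w : L2 m) : Integrable (fun x => ‖w x‖ ^ 2) μ :=
  (Lp.memLp w).integrable_norm_pow two_ne_zero

theorem norm_sq_eq_integral {m : ℕ} (w : L2 m) : ‖w‖ ^ 2 = ∫ x, ‖w x‖ ^ 2 ∂μ := by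
  rw [← real_inner_self_eq_norm_sq, L2.inner_def]
  simp only [real_inner_self_eq_norm_sq]

theorem integral_const_μ (c : ℝ) : ∫ _, c ∂μ = 2 * Real.pi * c := by
  rw [integral_const, smul_eq_mul, Measure.real, Measure.restrict_apply_univ, Real.volume_Ioo,
    ENNReal.toReal_ofReal (by linarith [Real.pi_pos])]
  ring

section

variable {m : ℕ} {f : E m → (E m →L[ℝ] E m)} {g : E m → E m} {K : ℝ}

theorem IsTame.pointwise_le (hK : IsTame f g K) (y z : E m) : ‖-f y z - g y‖ ≤ K * ‖z‖ + K := by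
  refine (norm_sub_le _ _).trans (add_le_add ?_ (hK.g_le y))
  rw [norm_neg]
  exact (f y).le_of_opNorm_le (hK.f_le y) z

theorem IsTame.aestronglyMeasurable (hK : IsTame f g K) {y z : ℝ → E m}
    (hy : AEStronglyMeasurable y μ) (hz : AEStronglyMeasurable z μ) :
    AEStronglyMeasurable (fun x => -f (y x) (z x) - g (y x)) μ := by
  have h1 : AEStronglyMeasurable (fun x => f (y x)) μ := hK.cont_f.comp_aestronglyMeasurable hy
  have h2 : AEStronglyMeasurable (fun x => g (y x)) μ := hK.cont_g.comp_aestronglyMeasurable hy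
  have h3 : AEStronglyMeasurable (fun x => f (y x) (z x)) μ :=
    (ContinuousLinearMap.id ℝ (E m →L[ℝ] E m)).aestronglyMeasurable_comp₂ h1 hz
  exact h3.neg.sub h2

theorem IsTame.memLp (hK : IsTame f g K) (u : Hper m 1) :
    MemLp (fun x => -f (D 0 u x) (D 1 u x) - g (D 0 u x)) 2 μ := by
  have h0 : MemLp (fun x => K * ‖D 1 u x‖) 2 μ := (Lp.memLp (D 1 u)).norm.const_mul K
  have h1 : MemLp (fun x => K * ‖D 1 u x‖ + K) 2 μ := h0.add (memLp_const K)
  exact h1.mono' (hK.aestronglyMeasurable (Lp.memLp (D 0 u)).aestronglyMeasurable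
    (Lp.memLp (D 1 u)).aestronglyMeasurable) (ae_of_all _ fun x => hK.pointwise_le _ _)

theorem IsTame.coeFn_nonlin (hK : IsTame f g K) (u : Hper m 1) :
    nonlin f g u =ᵐ[μ] fun x => -f (D 0 u x) (D 1 u x) - g (D 0 u x) := by
  rw [nonlin, dif_pos (hK.memLp u)]
  exact MemLp.coeFn_toLp _

theorem IsTame.norm_nonlin_sq_le (hK : IsTame f g K) (u : Hper m 1) :
    ‖nonlin f g u‖ ^ 2 ≤ 2 * K ^ 2 * ‖D 1 u‖ ^ 2 + 2 * Real.pi * (2 * K ^ 2) := by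
  rw [norm_sq_eq_integral, norm_sq_eq_integral, ← integral_const_μ, ← integral_const_mul,
    ← integral_add ((integrable_norm_sq _).const_mul _) (integrable_const _)]
  refine integral_mono_ae (integrable_norm_sq _)
    (((integrable_norm_sq _).const_mul _).add (integrable_const _)) ?_
  filter_upwards [hK.coeFn_nonlin u] with x hx
  rw [hx]
  have h1 := hK.pointwise_le (D 0 u x) (D 1 u x)
  have h2 := pow_le_pow_left₀ (norm_nonneg _) h1 2
  nlinarith [sq_nonneg (K * ‖D 1 u x‖ - K)]

/-- The decay bounds make the integrand at most `K‖∂ₓu‖ + K`, linear in the gradient. Young's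
inequality then leaves the coefficient `1/2`, small enough for diffusion to absorb. -/
theorem IsTame.inner_nonlin_le (hK : IsTame f g K) (u : Hper m 1) :
    inner ℝ (nonlin f g u) (D 0 u) ≤ 2⁻¹ * ‖D 1 u‖ ^ 2 + 2 * Real.pi * (K ^ 2 + K) := by
  rw [L2.inner_def, norm_sq_eq_integral, ← integral_const_μ, ← integral_const_mul,
    ← integral_add ((integrable_norm_sq _).const_mul _) (integrable_const _)]
  refine integral_mono_ae (L2.integrable_inner _ _)
    (((integrable_norm_sq _).const_mul _).add (integrable_const _)) ?_
  filter_upwards [hK.coeFn_nonlin u] with x hx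
  rw [hx]
  generalize D 0 u x = y
  generalize D 1 u x = z
  have h1 : ‖-f y z - g y‖ ≤ ‖f y‖ * ‖z‖ + ‖g y‖ := by
    refine (norm_sub_le _ _).trans (add_le_add ?_ le_rfl)
    rw [norm_neg]
    exact (f y).le_opNorm z
  have h2 := mul_le_mul_of_nonneg_right (hK.f_decay y) (norm_nonneg z)
  calc inner ℝ (-f y z - g y) y ≤ ‖-f y z - g y‖ * ‖y‖ := real_inner_le_norm _ _
    _ ≤ (‖f y‖ * ‖z‖ + ‖g y‖) * ‖y‖ := mul_le_mul_of_nonneg_right h1 (norm_nonneg _)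
    _ = ‖f y‖ * ‖y‖ * ‖z‖ + ‖g y‖ * ‖y‖ := by ring
    _ ≤ K * ‖z‖ + K := add_le_add h2 (hK.g_decay y)
    _ ≤ _ := by nlinarith [sq_nonneg (K - ‖z‖), sq_nonneg K]

theorem IsTame.pointwise_sub_le (hK : IsTame f g K) (y z y' z' : E m) :
    ‖(-f y z - g y) - (-f y' z' - g y')‖ ≤
      K * ‖z - z'‖ + K * ‖y - y'‖ * ‖z'‖ + K * ‖y - y'‖ := by
  have e : (-f y z - g y) - (-f y' z' - g y') =
      -(f y (z - z')) - (f y - f y') z' - (g y - g y') := by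
    rw [map_sub, sub_apply]
    abel
  rw [e]
  refine (norm_sub_le _ _).trans (add_le_add ((norm_sub_le _ _).trans (add_le_add ?_ ?_))
    (hK.g_lip _ _))
  · rw [norm_neg]
    exact (f y).le_of_opNorm_le (hK.f_le y) _
  · exact (f y - f y').le_of_opNorm_le (hK.f_lip _ _) _

/-- The critical term `(f(u) - f(v))∂ₓv` is handled by the sup bound on `u - v`. The splitting puts
all the remaining size on `v`, so the constant does not involve `‖u‖`. -/
theorem IsTame.exists_lipschitz (hK : IsTame f g K) : ∃ L : ℝ, 0 ≤ L ∧ ∀ u v : Hper m 1,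
    ‖nonlin f g u - nonlin f g v‖ ≤ L * (1 + ‖v‖) * ‖u - v‖ := by
  obtain ⟨C, hC, hsup⟩ := exists_sup_bound m
  refine ⟨√(3 * K ^ 2 * (1 + C ^ 2)), Real.sqrt_nonneg _, fun u v => ?_⟩
  have key : ‖nonlin f g u - nonlin f g v‖ ^ 2 ≤
      3 * K ^ 2 * ‖D 1 (u - v)‖ ^ 2 + 3 * K ^ 2 * ‖D 0 (u - v)‖ ^ 2 +
        3 * K ^ 2 * (C * ‖u - v‖) ^ 2 * ‖D 1 v‖ ^ 2 := by
    rw [norm_sq_eq_integral, norm_sq_eq_integral (D 1 (u - v)), norm_sq_eq_integral (D 0 (u - v)),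
      norm_sq_eq_integral (D 1 v), ← integral_const_mul, ← integral_const_mul,
      ← integral_const_mul, ← integral_add ((integrable_norm_sq _).const_mul _)
        ((integrable_norm_sq _).const_mul _),
      ← integral_add (((integrable_norm_sq _).const_mul _).fun_add
        ((integrable_norm_sq _).const_mul _)) ((integrable_norm_sq _).const_mul _)]
    refine integral_mono_ae (integrable_norm_sq _) ((((integrable_norm_sq _).const_mul _).fun_add
        ((integrable_norm_sq _).const_mul _)).fun_add ((integrable_norm_sq _).const_mul _)) ?_
    filter_upwards [hK.coeFn_nonlin u, hK.coeFn_nonlin v, hsup (u - v),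
      Lp.coeFn_sub (nonlin f g u) (nonlin f g v), Lp.coeFn_sub (D 0 u) (D 0 v),
      Lp.coeFn_sub (D 1 u) (D 1 v)] with x h1 h2 h3 h4 h5 h6
    simp only [h4, Pi.sub_apply, h1, h2, D_sub, h5, h6] at h3 ⊢
    have h7 := hK.pointwise_sub_le (D 0 u x) (D 1 u x) (D 0 v x) (D 1 v x)
    have h8 := pow_le_pow_left₀ (norm_nonneg _) h7 2
    have h9 := pow_le_pow_left₀ (norm_nonneg _) h3 2
    have h10 : 3 * K ^ 2 * (‖D 0 u x - D 0 v x‖ ^ 2 * ‖D 1 v x‖ ^ 2) ≤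
        3 * K ^ 2 * ((C * ‖u - v‖) ^ 2 * ‖D 1 v x‖ ^ 2) := by gcongr
    generalize ‖D 0 u x - D 0 v x‖ = a at *
    generalize ‖D 1 u x - D 1 v x‖ = b at *
    generalize ‖D 1 v x‖ = c at *
    nlinarith [sq_nonneg (K * b - K * a * c), sq_nonneg (K * b - K * a),
      sq_nonneg (K * a * c - K * a)]
  have h1 := norm_sq_H1 (u - v)
  have h2 := norm_D1_le v
  have h3 : 0 ≤ 3 * K ^ 2 := by positivity
  refine abs_le_of_sq_le_sq' ?_ (by positivity) |>.2
  rw [mul_pow, mul_pow, Real.sq_sqrt (by positivity)]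
  calc _ ≤ 3 * K ^ 2 * ‖u - v‖ ^ 2 + 3 * K ^ 2 * (C * ‖u - v‖) ^ 2 * ‖v‖ ^ 2 := by
        refine key.trans ?_
        rw [h1, mul_add]
        have : 3 * K ^ 2 * (C * ‖u - v‖) ^ 2 * ‖D 1 v‖ ^ 2 ≤
          3 * K ^ 2 * (C * ‖u - v‖) ^ 2 * ‖v‖ ^ 2 := by gcongr
        linarith
    _ = 3 * K ^ 2 * ‖u - v‖ ^ 2 * (1 + C ^ 2 * ‖v‖ ^ 2) := by ring
    _ ≤ 3 * K ^ 2 * ‖u - v‖ ^ 2 * ((1 + C ^ 2) * (1 + ‖v‖) ^ 2) := by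
        gcongr
        nlinarith [norm_nonneg v, sq_nonneg C, sq_nonneg ‖v‖, mul_nonneg (sq_nonneg C)
          (norm_nonneg v)]
    _ = _ := by ring

theorem IsTame.continuous_nonlin (hK : IsTame f g K) : Continuous (nonlin f g) := by
  obtain ⟨L, -, hL⟩ := hK.exists_lipschitz
  refine continuous_iff_continuousAt.2 fun v => ?_
  rw [ContinuousAt, tendsto_iff_norm_sub_tendsto_zero]
  refine squeeze_zero (fun _ => norm_nonneg _) (fun u => hL u v) ?_
  have : Continuous fun u : Hper m 1 => L * (1 + ‖v‖) * ‖u - v‖ := by fun_prop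
  simpa using this.tendsto v

end

/-! ### Dissipativity, uniqueness and smoothing -/

theorem UpperSlope.const_mul {y : ℝ → ℝ} {t c M : ℝ} (hM : 0 < M) (hy : UpperSlope y t c) :
    UpperSlope (fun s => M * y s) t (M * c) := by
  intro r hr
  filter_upwards [hy (r / M) (by rwa [lt_div_iff₀' hM])] with s h1
  have : slope (fun s => M * y s) t s = M * slope y t s := by
    simp only [slope_def_field]
    ring
  rw [this]
  rwa [lt_div_iff₀' hM] at h1

section

variable {m : ℕ} {f : E m → (E m →L[ℝ] E m)} {g : E m → E m} {K : ℝ}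

/-- Solutions of the nonlinear equation in terms of Fourier coefficients. -/
abbrev IsMildSol {m : ℕ} (f : E m → (E m →L[ℝ] E m)) (g : E m → E m) (T : ℝ)
    (u : ℝ → Hper m 1) : Prop :=
  IsMild T (fun t => nonlin f g (u t)) u

theorem IsTame.exists_dissipative (hK : IsTame f g K) : ∃ C γ : ℝ, 1 ≤ C ∧ 0 < γ ∧
    ∀ (T : ℝ) (u : ℝ → Hper m 1), IsMildSol f g T u →
      ∀ t ∈ Icc 0 T, ‖u t‖ ≤ C * Real.exp (-γ * t) * ‖u 0‖ + C := by
  -- The gradient terms contribute `2K² + M` and the dissipation `-2M`; this `M` makes the total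
  -- `-1`. `C₀` collects the constants.
  obtain ⟨M, hM⟩ : ∃ M, M = 2 * K ^ 2 + 1 := ⟨_, rfl⟩
  obtain ⟨C₀, hC₀⟩ : ∃ C₀, C₀ = 2 * Real.pi * (2 * K ^ 2) +
    2 * M * (2 * Real.pi * (K ^ 2 + K)) := ⟨_, rfl⟩
  have hKn := hK.nonneg
  have hMpos : 1 ≤ M := by nlinarith [sq_nonneg K]
  have hC₀' : 0 ≤ C₀ := by
    have := Real.pi_pos
    rw [hC₀]
    positivity
  -- The rate is halved because Gronwall controls the square of the norm; `(1 + M)⁻¹` compares the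
  -- functional with `‖u‖²`.
  refine ⟨1 + M + C₀, (1 + M)⁻¹ / 2, by linarith, by positivity, fun T u hu t ht => ?_⟩
  have hcont : ContinuousOn (fun s => ‖u s‖ ^ 2 + M * ‖D 0 (u s)‖ ^ 2) (Icc 0 T) := by
    have h1 : ContinuousOn (fun s => D 0 (u s)) (Icc 0 T) :=
      (DL 0).continuous.comp_continuousOn hu.cont_u
    exact (hu.cont_u.norm.pow 2).add ((h1.norm.pow 2).const_smul M)
  have hslope : ∀ s ∈ Ico 0 T, UpperSlope (fun s => ‖u s‖ ^ 2 + M * ‖D 0 (u s)‖ ^ 2) s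
      (-(1 + M)⁻¹ * (‖u s‖ ^ 2 + M * ‖D 0 (u s)‖ ^ 2) + C₀) := by
    intro s hs
    refine ((hu.upperSlope_norm_sq hs).add
      ((hu.upperSlope_norm_D0_sq hs).const_mul (one_pos.trans_le hMpos))).mono ?_
    have h1 := hK.norm_nonlin_sq_le (u s)
    have h2 := mul_le_mul_of_nonneg_left (hK.inner_nonlin_le (u s)) (by positivity : 0 ≤ 2 * M)
    have h3 := norm_sq_H1 (u s)
    have h4 : (1 + M)⁻¹ * (‖u s‖ ^ 2 + M * ‖D 0 (u s)‖ ^ 2) ≤ ‖u s‖ ^ 2 := by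
      rw [inv_mul_le_iff₀ (by positivity)]
      nlinarith [sq_nonneg ‖D 1 (u s)‖]
    have h5 : ‖D 1 (u s)‖ ^ 2 ≤ ‖u s‖ ^ 2 := by nlinarith [sq_nonneg ‖D 0 (u s)‖]
    rw [hC₀]
    have h6 : (2 * K ^ 2 + M) * ‖D 1 (u s)‖ ^ 2 ≤ (2 * K ^ 2 + M) * ‖u s‖ ^ 2 := by gcongr
    have h7 : 2 * K ^ 2 * ‖u s‖ ^ 2 = (M - 1) * ‖u s‖ ^ 2 := by rw [hM]; ring
    linarith
  have hy := le_gronwallBound_of_upperSlope hcont hslope ht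
  have hne : -(1 + M)⁻¹ ≠ 0 := neg_ne_zero.2 (by positivity)
  rw [gronwallBound_of_K_ne_0 hne, sub_zero] at hy
  have h0 : ‖u 0‖ ^ 2 + M * ‖D 0 (u 0)‖ ^ 2 ≤ (1 + M) * ‖u 0‖ ^ 2 := by
    have := norm_sq_H1 (u 0)
    nlinarith [mul_nonneg (zero_le_one.trans hMpos) (sq_nonneg ‖D 1 (u 0)‖)]
  have he : Real.exp (-(1 + M)⁻¹ * t) = Real.exp (-((1 + M)⁻¹ / 2) * t) ^ 2 := by
    rw [← Real.exp_nat_mul]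
    congr 1
    push_cast
    ring
  have hepos := Real.exp_pos (-((1 + M)⁻¹ / 2) * t)
  beta_reduce at hy
  rw [he] at hy
  generalize Real.exp (-((1 + M)⁻¹ / 2) * t) = e at *
  have h8 : C₀ / -(1 + M)⁻¹ * (e ^ 2 - 1) ≤ C₀ * (1 + M) := by
    have : C₀ / -(1 + M)⁻¹ * (e ^ 2 - 1) = C₀ * (1 + M) * (1 - e ^ 2) := by
      field_simp
      ring
    rw [this]
    exact mul_le_of_le_one_right (by positivity) (by nlinarith)
  have h9 := mul_le_mul_of_nonneg_right h0 (sq_nonneg e)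
  have h10 : ‖u t‖ ^ 2 ≤ (1 + M) * ‖u 0‖ ^ 2 * e ^ 2 + C₀ * (1 + M) := by
    nlinarith [mul_nonneg (zero_le_one.trans hMpos) (sq_nonneg ‖D 0 (u t)‖)]
  refine abs_le_of_sq_le_sq' ?_ (by positivity) |>.2
  calc ‖u t‖ ^ 2 ≤ (1 + M) * ‖u 0‖ ^ 2 * e ^ 2 + C₀ * (1 + M) := h10
    _ ≤ (1 + M + C₀) ^ 2 * (‖u 0‖ ^ 2 * e ^ 2) + (1 + M + C₀) ^ 2 := by
        have a1 : 1 + M ≤ (1 + M + C₀) ^ 2 := by nlinarith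
        have a2 : C₀ * (1 + M) ≤ (1 + M + C₀) ^ 2 := by nlinarith
        have a3 : 0 ≤ ‖u 0‖ ^ 2 * e ^ 2 := by positivity
        nlinarith
    _ ≤ _ := by
        have : 0 ≤ (1 + M + C₀) * e * ‖u 0‖ * (1 + M + C₀) := by positivity
        nlinarith

/-- In the energy identity for `u - v` the Lipschitz term is split by Young's inequality, and its
`H¹` part is absorbed by the dissipation. -/
theorem IsTame.exists_stable (hK : IsTame f g K) : ∃ L : ℝ, 0 ≤ L ∧
    ∀ (T R : ℝ) (u v : ℝ → Hper m 1), IsMildSol f g T u → IsMildSol f g T v →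
      (∀ t ∈ Icc 0 T, ‖v t‖ ≤ R) → ∀ t ∈ Icc 0 T,
        ‖D 0 (u t - v t)‖ ^ 2 ≤ Real.exp ((L * (1 + R)) ^ 2 * t) * ‖D 0 (u 0 - v 0)‖ ^ 2 := by
  obtain ⟨L, hL, hlip⟩ := hK.exists_lipschitz
  refine ⟨L, hL, fun T R u v hu hv hR t ht => ?_⟩
  have hw := hu.sub hv
  have hcont : ContinuousOn (fun s => ‖D 0 (u s - v s)‖ ^ 2) (Icc 0 T) := by
    have h1 : ContinuousOn (fun s => D 0 (u s - v s)) (Icc 0 T) :=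
      (DL 0).continuous.comp_continuousOn hw.cont_u
    exact h1.norm.pow 2
  have := le_gronwallBound_of_upperSlope (K := (L * (1 + R)) ^ 2) (ε := 0) hcont
    (fun s hs => (hw.upperSlope_norm_D0_sq hs).mono ?_) ht
  · rwa [gronwallBound_ε0, sub_zero, mul_comm] at this
  · have h1 := real_inner_le_norm (nonlin f g (u s) - nonlin f g (v s)) (D 0 (u s - v s))
    have h2 := mul_le_mul_of_nonneg_right (hlip (u s) (v s)) (norm_nonneg (D 0 (u s - v s)))
    have h3 : L * (1 + ‖v s‖) * ‖u s - v s‖ * ‖D 0 (u s - v s)‖ ≤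
        L * (1 + R) * ‖u s - v s‖ * ‖D 0 (u s - v s)‖ := by
      have := hR s (Ico_subset_Icc_self hs)
      gcongr
    nlinarith [sq_nonneg (‖u s - v s‖ - L * (1 + R) * ‖D 0 (u s - v s)‖), sq_nonneg ‖u s - v s‖]

theorem IsTame.unique (hK : IsTame f g K) {T : ℝ} {u v : ℝ → Hper m 1} (hu : IsMildSol f g T u)
    (hv : IsMildSol f g T v) (h0 : u 0 = v 0) : EqOn u v (Icc 0 T) := by
  obtain ⟨R, hR⟩ := isCompact_Icc.exists_bound_of_continuousOn hv.cont_u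
  obtain ⟨L, -, hL⟩ := hK.exists_stable
  intro t ht
  have := hL T R u v hu hv hR t ht
  rw [h0, sub_self, ← DL_apply 0 (0 : Hper m 1), map_zero, norm_zero, zero_pow two_ne_zero,
    mul_zero] at this
  have h1 : D 0 (u t - v t) = 0 := by
    rw [← norm_eq_zero, ← sq_eq_zero_iff]
    exact le_antisymm this (sq_nonneg _)
  rw [← sub_eq_zero]
  refine ext_co fun κ => ?_
  rw [co_apply, h1, map_zero, map_zero]

theorem exists_H2_of_sum_le {v : Hper m 1} {B : ℝ}
    (h : ∀ F : Finset (ℤ × Fin m), ∑ κ ∈ F, (lam κ * co κ v) ^ 2 ≤ B) :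
    ∃ U : Hper m 2, toH1 U = v ∧ ‖U‖ ^ 2 ≤ B := by
  obtain ⟨U, hU⟩ := exists_H2_of_summable (c := fun κ => co κ v)
    (summable_of_sum_le (fun _ => sq_nonneg _) h)
  refine ⟨U, ext_co hU, ?_⟩
  refine le_of_tendsto (hasSum_norm_H2 U) (Eventually.of_forall fun F => le_trans ?_ (h F))
  refine Finset.sum_le_sum fun κ _ => ?_
  rw [hU, mul_pow]
  refine mul_le_mul_of_nonneg_right ?_ (sq_nonneg _)
  rw [lam]
  nlinarith [sq_nonneg (κ.1 : ℝ)]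

/-- A bound for the discrete time derivative at the end of a time interval by its averages. -/
theorem IsTame.sq_norm_sub_le {L R b t : ℝ} {u : ℝ → Hper m 1}
    (hL : ∀ (T R : ℝ) (u v : ℝ → Hper m 1), IsMildSol f g T u → IsMildSol f g T v →
      (∀ t ∈ Icc 0 T, ‖v t‖ ≤ R) → ∀ t ∈ Icc 0 T,
        ‖D 0 (u t - v t)‖ ^ 2 ≤ Real.exp ((L * (1 + R)) ^ 2 * t) * ‖D 0 (u 0 - v 0)‖ ^ 2)
    (ht0 : 0 < t) (ht1 : t ≤ 1) (hu : IsMildSol f g t u) (hR : ∀ s ∈ Icc 0 t, ‖u s‖ ≤ R)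
    (hb : ∀ s ∈ Icc 0 t, ‖nonlin f g (u s)‖ ≤ b) (N : ℕ) :
    t * ‖D 0 (u t - u (t - t / (N + 1)))‖ ^ 2 ≤
      (t / (N + 1)) ^ 2 * (Real.exp ((L * (1 + R)) ^ 2) * (R ^ 2 + b ^ 2)) := by
  set δ : ℝ := t / (N + 1) with hδ
  have hN : (0 : ℝ) < N + 1 := by positivity
  have hδ0 : 0 < δ := by positivity
  have hNδ : (N + 1) * δ = t := by rw [hδ]; field_simp
  set e := Real.exp ((L * (1 + R)) ^ 2) with he
  -- Stability compares `u` with its translate by `δ`: the increment ending at `t` is controlled by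
  -- the increment over `[jδ, (j+1)δ]`, for every `j`.
  have hterm : ∀ j ∈ Finset.range (N + 1), ‖D 0 (u t - u (t - δ))‖ ^ 2 ≤
      e * (δ * (‖u (j * δ)‖ ^ 2 - ‖u ((j + 1 : ℕ) * δ)‖ ^ 2 + δ * b ^ 2)) := by
    intro j hj
    have hjN : (j : ℝ) + 1 ≤ N + 1 := by exact_mod_cast Finset.mem_range.1 hj
    have hjt : (j + 1) * δ ≤ t := by rw [← hNδ]; gcongr
    have hj0 : 0 ≤ (j : ℝ) * δ := by positivity
    have h1 := hL (t - (j + 1) * δ) R _ _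
      (hu.shift (s := (j + 1) * δ) (T' := t - (j + 1) * δ) (by positivity) (by linarith))
      (hu.shift (s := j * δ) (T' := t - (j + 1) * δ) hj0 (by linarith))
      (fun s hs => hR _ ⟨by linarith [hs.1], by linarith [hs.2]⟩) (t - (j + 1) * δ)
      ⟨by linarith, le_rfl⟩
    have h2 := hu.step (s := j * δ) (t := (j + 1) * δ) (b := b) hj0 (by linarith) hjt
      (fun s hs => hb s ⟨by linarith [hs.1], by linarith [hs.2]⟩)
    have e1 : t - (j + 1) * δ + (j + 1) * δ = t := by ring
    have e2 : t - (j + 1) * δ + j * δ = t - δ := by ring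
    have e3 : (j + 1) * δ - j * δ = δ := by ring
    rw [e1, e2, zero_add, zero_add] at h1
    rw [e3] at h2
    push_cast
    have h3 : Real.exp ((L * (1 + R)) ^ 2 * (t - (j + 1) * δ)) ≤ e := by
      refine Real.exp_le_exp.2 (mul_le_of_le_one_right (sq_nonneg _) ?_)
      nlinarith
    refine h1.trans (mul_le_mul h3 ?_ (sq_nonneg _) (Real.exp_pos _).le)
    linarith
  -- Summing over all `N + 1` intervals makes the `H¹` norms telescope.
  have hsum := Finset.sum_le_sum hterm
  rw [Finset.sum_const, Finset.card_range, nsmul_eq_mul, ← Finset.mul_sum, ← Finset.mul_sum,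
    Finset.sum_add_distrib, Finset.sum_range_sub' (fun j : ℕ => ‖u (j * δ)‖ ^ 2), Finset.sum_const,
    Finset.card_range, nsmul_eq_mul] at hsum
  push_cast at hsum
  rw [zero_mul] at hsum
  have h0 := hR 0 ⟨le_rfl, ht0.le⟩
  have h0' := pow_le_pow_left₀ (norm_nonneg _) h0 2
  have h5 : ‖u 0‖ ^ 2 - ‖u ((N + 1) * δ)‖ ^ 2 + (N + 1) * (δ * b ^ 2) ≤ R ^ 2 + b ^ 2 := by
    rw [← mul_assoc, hNδ]
    nlinarith [sq_nonneg ‖u t‖, sq_nonneg b]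
  have hepos : 0 < e := Real.exp_pos _
  calc t * ‖D 0 (u t - u (t - δ))‖ ^ 2 = δ * ((N + 1) * ‖D 0 (u t - u (t - δ))‖ ^ 2) := by
        rw [← mul_assoc, mul_comm δ, hNδ]
    _ ≤ δ * (e * (δ * (R ^ 2 + b ^ 2))) := by
        refine mul_le_mul_of_nonneg_left (hsum.trans ?_) hδ0.le
        gcongr
    _ = _ := by ring

/-- Letting `N → ∞` turns difference quotients into derivatives of finitely many modes, so
`t‖∂ₜu(t)‖² ≤ B` is obtained without differentiating the equation in time. -/
theorem IsMild.sum_deriv_sq_le {h : ℝ → L2 m} {u : ℝ → Hper m 1} {t B : ℝ} (ht : 0 < t)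
    (hu : IsMild t h u)
    (hB : ∀ N : ℕ, t * ‖D 0 (u t - u (t - t / (N + 1)))‖ ^ 2 ≤ (t / (N + 1)) ^ 2 * B)
    (F : Finset (ℤ × Fin m)) :
    t * ∑ κ ∈ F, (-lam κ * co κ (u t) + cf κ (h t)) ^ 2 ≤ B := by
  have hseq : Tendsto (fun N : ℕ => t - t / ((N : ℝ) + 1)) atTop (𝓝[Icc 0 t \ {t}] t) := by
    refine tendsto_nhdsWithin_iff.2 ⟨?_, Eventually.of_forall fun N => ?_⟩
    · have := (tendsto_one_div_add_atTop_nhds_zero_nat (𝕜 := ℝ)).const_mul t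
      simpa [div_eq_mul_inv] using this.const_sub t
    · have h1 : 0 < t / ((N : ℝ) + 1) := by positivity
      have h2 : t / ((N : ℝ) + 1) ≤ t := div_le_self ht.le (by linarith [Nat.cast_nonneg (α := ℝ) N])
      exact ⟨⟨by linarith, by linarith⟩, (sub_lt_self t h1).ne⟩
  have hlim : Tendsto (fun N : ℕ => t * ∑ κ ∈ F,
      (slope (fun s => co κ (u s)) t (t - t / ((N : ℝ) + 1))) ^ 2) atTop
      (𝓝 (t * ∑ κ ∈ F, (-lam κ * co κ (u t) + cf κ (h t)) ^ 2)) := by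
    refine (tendsto_finsetSum F fun κ _ => Tendsto.pow ?_ 2).const_mul t
    exact (hasDerivWithinAt_iff_tendsto_slope.1 (hu.hasDeriv κ t ⟨ht.le, le_rfl⟩)).comp hseq
  refine le_of_tendsto hlim (Eventually.of_forall fun N => ?_)
  have hδ : 0 < t / ((N : ℝ) + 1) := by positivity
  have h1 : ∀ κ, (slope (fun s => co κ (u s)) t (t - t / ((N : ℝ) + 1))) ^ 2 =
      ((t / ((N : ℝ) + 1)) ^ 2)⁻¹ * cf κ (D 0 (u t - u (t - t / ((N : ℝ) + 1)))) ^ 2 := by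
    intro κ
    rw [slope_def_field, ← co_apply, map_sub, div_pow, div_eq_inv_mul]
    congr 1
    · congr 1
      ring
    · ring
  simp only [h1, ← Finset.mul_sum]
  have h2 := sum_cf_sq_le (D 0 (u t - u (t - t / ((N : ℝ) + 1)))) F
  have h3 := mul_le_mul_of_nonneg_left h2 ht.le
  rw [mul_left_comm, inv_mul_le_iff₀ (by positivity)]
  exact h3.trans (hB N)

/-- Each mode satisfies `λc = h - c'`: the bound on `t‖∂ₜu‖²` and the `L²` bound on the nonlinearity
control `t‖Au‖²`. -/
theorem IsTame.exists_smoothing_short (hK : IsTame f g K) : ∃ P : ℝ → ℝ, Monotone P ∧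
    (∀ r, 0 ≤ P r) ∧ ∀ (R t : ℝ) (u : ℝ → Hper m 1), 0 < t → t ≤ 1 → IsMildSol f g t u →
      (∀ s ∈ Icc 0 t, ‖u s‖ ≤ R) → ∃ U : Hper m 2, toH1 U = u t ∧ ‖U‖ ≤ (√t)⁻¹ * P R := by
  obtain ⟨L, hL0, hL⟩ := hK.exists_stable
  have hKn := hK.nonneg
  have hpi := Real.pi_pos
  let b2 : ℝ → ℝ := fun R => 2 * K ^ 2 * R ^ 2 + 2 * Real.pi * (2 * K ^ 2)
  let P0 : ℝ → ℝ := fun R =>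
    2 * (Real.exp ((L * (1 + R)) ^ 2) * (R ^ 2 + b2 R)) + 2 * b2 R
  have hmono : ∀ r r', 0 ≤ r → r ≤ r' → P0 r ≤ P0 r' := by
    intro r r' h0 hrr
    simp only [P0, b2]
    gcongr
  -- `P0` is monotone only on `r ≥ 0`, hence the truncation.
  refine ⟨fun r => √(P0 (max r 0)), fun r r' hrr => Real.sqrt_le_sqrt
    (hmono _ _ (le_max_right _ _) (max_le_max_right _ hrr)), fun r => Real.sqrt_nonneg _,
    fun R t u ht0 ht1 hu hR => ?_⟩
  have hR0 : 0 ≤ R := (norm_nonneg _).trans (hR 0 ⟨le_rfl, ht0.le⟩)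
  simp only [max_eq_left hR0]
  have hb2 : 0 ≤ b2 R := by positivity
  have hb : ∀ s ∈ Icc 0 t, ‖nonlin f g (u s)‖ ^ 2 ≤ b2 R := by
    intro s hs
    refine (hK.norm_nonlin_sq_le (u s)).trans ?_
    have := (norm_D1_le (u s)).trans (hR s hs)
    simp only [b2]
    gcongr
  have hB := (hu.sum_deriv_sq_le ht0 (B := Real.exp ((L * (1 + R)) ^ 2) * (R ^ 2 + b2 R))
    fun N => by
      have := IsTame.sq_norm_sub_le hL ht0 ht1 hu hR (b := √(b2 R))
        (fun s hs => Real.le_sqrt_of_sq_le (hb s hs)) N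
      rwa [Real.sq_sqrt hb2] at this)
  obtain ⟨U, hU1, hU2⟩ := exists_H2_of_sum_le (v := u t) (B := P0 R / t) fun F => by
    rw [le_div_iff₀' ht0]
    have h1 := sum_cf_sq_le (nonlin f g (u t)) F
    have h2 := hb t ⟨ht0.le, le_rfl⟩
    calc t * ∑ κ ∈ F, (lam κ * co κ (u t)) ^ 2 ≤
        t * ∑ κ ∈ F, (2 * (-lam κ * co κ (u t) + cf κ (nonlin f g (u t))) ^ 2 +
          2 * cf κ (nonlin f g (u t)) ^ 2) := by
          refine mul_le_mul_of_nonneg_left (Finset.sum_le_sum fun κ _ => ?_) ht0.le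
          nlinarith [sq_nonneg (-lam κ * co κ (u t) + 2 * cf κ (nonlin f g (u t)))]
      _ = 2 * (t * ∑ κ ∈ F, (-lam κ * co κ (u t) + cf κ (nonlin f g (u t))) ^ 2) +
          t * (2 * ∑ κ ∈ F, cf κ (nonlin f g (u t)) ^ 2) := by
          rw [Finset.sum_add_distrib, ← Finset.mul_sum, ← Finset.mul_sum]
          ring
      _ ≤ 2 * (Real.exp ((L * (1 + R)) ^ 2) * (R ^ 2 + b2 R)) + 1 * (2 * b2 R) := by
          have := hB F
          gcongr
          exact h1.trans h2
      _ = P0 R := by simp only [P0, one_mul]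
  refine ⟨U, hU1, ?_⟩
  rw [← Real.sqrt_inv, ← Real.sqrt_mul (by positivity)]
  refine Real.le_sqrt_of_sq_le ?_
  rwa [inv_mul_eq_div]

theorem IsTame.exists_smoothing (hK : IsTame f g K) : ∃ (Q : ℝ → ℝ) (Cs : ℝ), Monotone Q ∧
    0 < Cs ∧ ∀ (T : ℝ) (u : ℝ → Hper m 1), IsMildSol f g T u → ∀ t ∈ Ioc 0 T,
      ∃ U : Hper m 2, toH1 U = u t ∧ ‖U‖ ≤ (√t)⁻¹ * Q ‖u 0‖ + Cs := by
  obtain ⟨P, hPm, hP0, hP⟩ := hK.exists_smoothing_short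
  obtain ⟨C, γ, hC, hγ, hdiss⟩ := hK.exists_dissipative
  have hC0 : 0 ≤ C := zero_le_one.trans hC
  -- For `t > 1` the short-time bound is applied on `[t-1, t]`. If `t - 1 ≥ C‖u 0‖/γ`, the initial
  -- norm has been forgotten there and `P (1 + C)` suffices. Otherwise `t < 1 + C‖u 0‖/γ`, and the
  -- square root factor compensates `(√t)⁻¹`.
  refine ⟨fun r => √(1 + C * max r 0 / γ) * P (C * max r 0 + C), P (1 + C) + 1, ?_, ?_, ?_⟩
  · intro r r' hrr
    have h1 : max r 0 ≤ max r' 0 := max_le_max_right _ hrr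
    refine mul_le_mul (Real.sqrt_le_sqrt (by gcongr)) (hPm (by gcongr)) (hP0 _)
      (Real.sqrt_nonneg _)
  · have := hP0 (1 + C)
    linarith
  intro T u hu t ht
  have hn := norm_nonneg (u 0)
  simp only [max_eq_left hn]
  have hP1 := hP0 (1 + C)
  have hst : 0 < √t := Real.sqrt_pos.2 ht.1
  have hbound : ∀ s ∈ Icc 0 T, ‖u s‖ ≤ C * ‖u 0‖ + C := by
    intro s hs
    refine (hdiss T u hu s hs).trans (add_le_add_left (mul_le_mul_of_nonneg_right ?_ hn) C)
    refine mul_le_of_le_one_right hC0 (Real.exp_le_one_iff.2 ?_)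
    nlinarith [hs.1]
  rcases le_or_gt t 1 with h1 | h1
  · obtain ⟨U, hU1, hU2⟩ := hP (C * ‖u 0‖ + C) t u ht.1 h1 (hu.mono ht.2)
      (fun s hs => hbound s ⟨hs.1, hs.2.trans ht.2⟩)
    refine ⟨U, hU1, hU2.trans ?_⟩
    have h2 : 1 ≤ √(1 + C * ‖u 0‖ / γ) := by
      rw [Real.one_le_sqrt]
      have : 0 ≤ C * ‖u 0‖ / γ := by positivity
      linarith
    have h3 := le_mul_of_one_le_left (hP0 (C * ‖u 0‖ + C)) h2
    have h4 := mul_le_mul_of_nonneg_left h3 (inv_nonneg.2 hst.le)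
    linarith
  · have hs0 : 0 ≤ t - 1 := by linarith
    have hv := hu.shift (s := t - 1) (T' := 1) hs0 (by linarith [ht.2])
    rcases le_or_gt (C * ‖u 0‖) (γ * (t - 1)) with h2 | h2
    · have hR : ∀ s ∈ Icc (0 : ℝ) 1, ‖u (s + (t - 1))‖ ≤ 1 + C := by
        intro s hs
        refine (hdiss T u hu _ ⟨by linarith [hs.1], by linarith [hs.2, ht.2]⟩).trans
          (add_le_add_left ?_ C)
        have h3 : Real.exp (-γ * (s + (t - 1))) ≤ Real.exp (-(γ * (t - 1))) := by
          refine Real.exp_le_exp.2 ?_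
          nlinarith [hs.1]
        have h4 := Real.add_one_le_exp (γ * (t - 1))
        calc C * Real.exp (-γ * (s + (t - 1))) * ‖u 0‖ ≤
            C * Real.exp (-(γ * (t - 1))) * ‖u 0‖ := by gcongr
          _ = C * ‖u 0‖ * (Real.exp (γ * (t - 1)))⁻¹ := by rw [Real.exp_neg]; ring
          _ ≤ 1 := by
              rw [← div_eq_mul_inv, div_le_one (Real.exp_pos _)]
              linarith
      obtain ⟨U, hU1, hU2⟩ := hP (1 + C) 1 _ one_pos le_rfl hv hR
      refine ⟨U, by simpa using hU1, hU2.trans ?_⟩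
      rw [Real.sqrt_one, inv_one, one_mul]
      have : 0 ≤ (√t)⁻¹ * (√(1 + C * ‖u 0‖ / γ) * P (C * ‖u 0‖ + C)) :=
        mul_nonneg (inv_nonneg.2 hst.le) (mul_nonneg (Real.sqrt_nonneg _) (hP0 _))
      linarith
    · obtain ⟨U, hU1, hU2⟩ := hP (C * ‖u 0‖ + C) 1 _ one_pos le_rfl hv
        (fun s hs => hbound _ ⟨by linarith [hs.1], by linarith [hs.2, ht.2]⟩)
      refine ⟨U, by simpa using hU1, hU2.trans ?_⟩
      rw [Real.sqrt_one, inv_one, one_mul]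
      have h3 : √t ≤ √(1 + C * ‖u 0‖ / γ) := by
        refine Real.sqrt_le_sqrt ?_
        have : t - 1 < C * ‖u 0‖ / γ := by rwa [lt_div_iff₀' hγ]
        linarith
      have h4 : 1 ≤ (√t)⁻¹ * √(1 + C * ‖u 0‖ / γ) := by
        rwa [← div_eq_inv_mul, one_le_div hst]
      have h5 := le_mul_of_one_le_left (hP0 (C * ‖u 0‖ + C)) h4
      rw [mul_assoc] at h5
      linarith

end

/-! ### Equivalence of the coefficientwise and the strong formulation -/

section

variable {m : ℕ} {T : ℝ} {h : ℝ → L2 m} {u : ℝ → Hper m 1}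

/-- Integrated in time, `(λa)² + 2λaa' = h² - a'² ≤ h²` for each mode, with `a' = -λa + h`. The
bound does not depend on `F`. -/
theorem IsMild.integral_sum_sq_le (hu : IsMild T h u) (hT : 0 ≤ T) (F : Finset (ℤ × Fin m)) :
    ∫ t in (0 : ℝ)..T, ∑ κ ∈ F, (lam κ * co κ (u t)) ^ 2 ≤
      ‖u 0‖ ^ 2 + ∫ t in (0 : ℝ)..T, ‖h t‖ ^ 2 := by
  let y : ℝ → ℝ := fun t => ∑ κ ∈ F, lam κ * co κ (u t) ^ 2
  let y' : ℝ → ℝ := fun t => ∑ κ ∈ F,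
    lam κ * (2 * co κ (u t) * (-lam κ * co κ (u t) + cf κ (h t)))
  have hco : ∀ κ, ContinuousOn (fun t => co κ (u t)) (Icc 0 T) := fun κ =>
    (co κ).continuous.comp_continuousOn hu.cont_u
  have hch : ∀ κ, ContinuousOn (fun t => cf κ (h t)) (Icc 0 T) := fun κ =>
    (cf κ).continuous.comp_continuousOn hu.cont_h
  have hd : ∀ t ∈ Icc 0 T, HasDerivWithinAt y (y' t) (Icc 0 T) t := by
    intro t ht
    refine HasDerivWithinAt.fun_sum fun κ _ => ?_
    convert! ((hu.hasDeriv κ t ht).pow 2).const_mul (lam κ) using 1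
    simp
  have hyc : ContinuousOn y' (Icc 0 T) :=
    continuousOn_finsetSum F fun κ _ => (((hco κ).const_smul (2 : ℝ)).mul
      (((hco κ).const_smul (-lam κ)).add (hch κ))).const_smul (lam κ)
  have hii : ∀ {z : ℝ → ℝ}, ContinuousOn z (Icc 0 T) → IntervalIntegrable z volume 0 T :=
    fun hz => ContinuousOn.intervalIntegrable (by rwa [uIcc_of_le hT])
  have hsc : ContinuousOn (fun t => ∑ κ ∈ F, (lam κ * co κ (u t)) ^ 2) (Icc 0 T) :=
    continuousOn_finsetSum F fun κ _ => ((hco κ).const_smul (lam κ)).pow 2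
  have hint : ∫ t in (0 : ℝ)..T, y' t = y T - y 0 :=
    intervalIntegral.integral_eq_sub_of_hasDeriv_right_of_le hT
      (fun t ht => (hd t ht).continuousWithinAt) (fun t ht =>
        (hd t (Ioo_subset_Icc_self ht)).mono_of_mem_nhdsWithin
          (Icc_mem_nhdsGT_of_mem (Ioo_subset_Ico_self ht))) (hii hyc)
  have hle : ∫ t in (0 : ℝ)..T, ((∑ κ ∈ F, (lam κ * co κ (u t)) ^ 2) + y' t) ≤
      ∫ t in (0 : ℝ)..T, ‖h t‖ ^ 2 := by
    refine intervalIntegral.integral_mono_on hT (hii (hsc.add hyc)) (hii (hu.cont_h.norm.pow 2))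
      fun t _ => ?_
    refine le_trans ?_ (sum_cf_sq_le (h t) F)
    rw [← Finset.sum_add_distrib]
    refine Finset.sum_le_sum fun κ _ => ?_
    nlinarith [sq_nonneg (lam κ * co κ (u t) - cf κ (h t))]
  rw [intervalIntegral.integral_add (hii hsc) (hii hyc), hint] at hle
  have h1 : 0 ≤ y T := Finset.sum_nonneg fun κ _ => mul_nonneg (lam_pos κ).le (sq_nonneg _)
  have h2 : y 0 ≤ ‖u 0‖ ^ 2 := sum_lam_co_sq_le (u 0) F
  linarith

theorem aestronglyMeasurable_Hper {α : Type*} [MeasurableSpace α] {ν : Measure α}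
    {U : α → Hper m 2} (h : ∀ j, AEStronglyMeasurable (fun t => D j (U t)) ν) :
    AEStronglyMeasurable U ν := by
  have hc : Continuous fun p : L2 m × L2 m × L2 m =>
      (WithLp.toLp 2 ![p.1, p.2.1, p.2.2] : PiLp 2 fun _ : Fin 3 => L2 m) := by
    refine (PiLp.continuous_toLp 2 _).comp (continuous_pi fun i => ?_)
    fin_cases i
    · exact continuous_fst
    · exact continuous_fst.comp continuous_snd
    · exact continuous_snd.comp continuous_snd
  have h1 := hc.comp_aestronglyMeasurable ((h 0).prodMk ((h 1).prodMk (h 2)))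
  rw [← Topology.IsEmbedding.subtypeVal.aestronglyMeasurable_comp_iff]
  refine h1.congr (ae_of_all _ fun t => ?_)
  refine PiLp.ext fun i => ?_
  fin_cases i <;> rfl

/-- Parabolic regularity: mild solutions belong to `L²(0,T; H²)`. -/
theorem IsMild.exists_memLp (hu : IsMild T h u) (hT : 0 ≤ T) : ∃ U : ℝ → Hper m 2,
    MemLp U 2 (volume.restrict (Ioo 0 T)) ∧
    ∀ᵐ t ∂(volume.restrict (Ioo 0 T)), toH1 (U t) = u t := by
  classical
  have hco : ∀ κ, ContinuousOn (fun t => co κ (u t)) (Ioo 0 T) := fun κ =>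
    (co κ).continuous.comp_continuousOn (hu.cont_u.mono Ioo_subset_Icc_self)
  let S : ℝ → ENNReal := fun t => ∑' κ, ENNReal.ofReal ((lam κ * co κ (u t)) ^ 2)
  have hmeas : ∀ κ, AEMeasurable (fun t => ENNReal.ofReal ((lam κ * co κ (u t)) ^ 2))
      (volume.restrict (Ioo 0 T)) := fun κ =>
    (((hco κ).const_smul (lam κ)).pow 2).aestronglyMeasurable measurableSet_Ioo
      |>.aemeasurable.ennreal_ofReal
  have hS : ∫⁻ t in Ioo 0 T, S t ≠ ⊤ := by
    have hb : ∫⁻ t in Ioo 0 T, S t ≤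
        ENNReal.ofReal (‖u 0‖ ^ 2 + ∫ t in (0 : ℝ)..T, ‖h t‖ ^ 2) := by
      rw [lintegral_tsum hmeas, ENNReal.tsum_eq_iSup_sum]
      refine iSup_le fun F => ?_
      rw [← lintegral_finsetSum' F fun κ _ => hmeas κ]
      refine le_trans (le_of_eq ?_) (ENNReal.ofReal_le_ofReal (hu.integral_sum_sq_le hT F))
      rw [intervalIntegral.integral_of_le hT, integral_Ioc_eq_integral_Ioo,
        ofReal_integral_eq_lintegral_ofReal]
      · refine lintegral_congr fun t => ?_
        rw [ENNReal.ofReal_sum_of_nonneg fun κ _ => sq_nonneg _]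
      · have : ContinuousOn (fun t => ∑ κ ∈ F, (lam κ * co κ (u t)) ^ 2) (Icc 0 T) :=
          continuousOn_finsetSum F fun κ _ =>
            (((co κ).continuous.comp_continuousOn hu.cont_u).const_smul (lam κ)).pow 2
        exact this.integrableOn_Icc.mono_set Ioo_subset_Icc_self
      · exact ae_of_all _ fun t => Finset.sum_nonneg fun κ _ => sq_nonneg _
    exact ne_top_of_le_ne_top ENNReal.ofReal_ne_top hb
  have hSm : AEMeasurable S (volume.restrict (Ioo 0 T)) := AEMeasurable.tsum hmeas
  have hfin : ∀ᵐ t ∂(volume.restrict (Ioo 0 T)), S t < ⊤ := ae_lt_top' hSm hS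
  -- The value `0` is used only outside the full-measure set `hfin`. The pointwise choice does not
  -- harm measurability, since `toH1 (U t) = u t` determines `U t`.
  let U : ℝ → Hper m 2 := fun t =>
    if H : ∃ V : Hper m 2, toH1 V = u t ∧ ‖V‖ ^ 2 ≤ (S t).toReal then H.choose else 0
  have hU : ∀ᵐ t ∂(volume.restrict (Ioo 0 T)),
      toH1 (U t) = u t ∧ ‖U t‖ ^ 2 ≤ (S t).toReal := by
    filter_upwards [hfin] with t ht
    have H : ∃ V : Hper m 2, toH1 V = u t ∧ ‖V‖ ^ 2 ≤ (S t).toReal := by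
      refine exists_H2_of_sum_le fun F => ?_
      rw [← ENNReal.ofReal_le_iff_le_toReal ht.ne, ENNReal.ofReal_sum_of_nonneg
        fun κ _ => sq_nonneg _]
      exact ENNReal.sum_le_tsum F
    simp only [U, dif_pos H]
    exact H.choose_spec
  refine ⟨U, ?_, hU.mono fun t ht => ht.1⟩
  have hcl : ∀ j, AEStronglyMeasurable (fun t => D j (u t)) (volume.restrict (Ioo 0 T)) :=
    fun j => ((DL j).continuous.comp_continuousOn
      (hu.cont_u.mono Ioo_subset_Icc_self)).aestronglyMeasurable measurableSet_Ioo
  have hUm : AEStronglyMeasurable U (volume.restrict (Ioo 0 T)) := by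
    refine aestronglyMeasurable_Hper fun j => ?_
    fin_cases j
    · refine (hcl 0).congr (hU.mono fun t ht => ?_)
      simp only [← ht.1]
      rfl
    · refine (hcl 1).congr (hU.mono fun t ht => ?_)
      simp only [← ht.1]
      rfl
    -- The second derivative is the a.e. limit of its partial Fourier sums, which are continuous in
    -- `t`.
    · refine aestronglyMeasurable_of_tendsto_ae (atTop : Filter (Finset (ℤ × Fin m)))
        (f := fun F t => ∑ κ ∈ F, (-(κ.1 : ℝ) ^ 2 * co κ (u t)) • (trig κ : L2 m)) (fun F => ?_)
        (hU.mono fun t ht => ?_)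
      · refine ContinuousOn.aestronglyMeasurable ?_ measurableSet_Ioo
        exact continuousOn_finsetSum F fun κ _ =>
          ((hco κ).const_smul (-(κ.1 : ℝ) ^ 2)).smul continuousOn_const
      · refine (hasSum_cf_smul (D 2 (U t))).congr fun F => Finset.sum_congr rfl fun κ _ => ?_
        beta_reduce
        rw [cf_D2, ← ht.1]
        rfl
  rw [memLp_two_iff_integrable_sq_norm hUm]
  refine ⟨(hUm.norm.pow 2), ?_⟩
  rw [hasFiniteIntegral_iff_ofReal (ae_of_all _ fun t => sq_nonneg _)]
  refine lt_of_le_of_lt (lintegral_mono_ae ?_) hS.lt_top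
  filter_upwards [hU, hfin] with t h1 h2
  exact ENNReal.ofReal_le_of_le_toReal h1.2

theorem IsMild.eq_integral (hu : IsMild T h u) (hT : 0 ≤ T) {U : ℝ → Hper m 2}
    (hU : MemLp U 2 (volume.restrict (Ioo 0 T)))
    (hUu : ∀ᵐ t ∂(volume.restrict (Ioo 0 T)), toH1 (U t) = u t) :
    IntervalIntegrable (fun t => D 2 (U t) - D 0 (U t) + h t) volume 0 T ∧
    ∀ t ∈ Icc 0 T, D 0 (u t) = D 0 (u 0) +
      ∫ s in (0 : ℝ)..t, (D 2 (U s) - D 0 (U s) + h s) := by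
  have hi : IntervalIntegrable (fun t => D 2 (U t) - D 0 (U t) + h t) volume 0 T := by
    rw [intervalIntegrable_iff_integrableOn_Ioo_of_le hT]
    have h1 : ∀ j, Integrable (fun t => D j (U t)) (volume.restrict (Ioo 0 T)) := fun j =>
      ((DL j).comp_memLp' hU).integrable (by norm_num)
    exact ((h1 2).sub (h1 0)).add (hu.cont_h.integrableOn_Icc.mono_set Ioo_subset_Icc_self)
  refine ⟨hi, fun t ht => ext_cf fun κ => ?_⟩
  have hsub : Icc 0 t ⊆ Icc 0 T := Icc_subset_Icc le_rfl ht.2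
  have hi' : IntervalIntegrable (fun t => D 2 (U t) - D 0 (U t) + h t) volume 0 t := by
    refine hi.mono_set ?_
    rw [uIcc_of_le ht.1, uIcc_of_le hT]
    exact hsub
  rw [map_add, ← ContinuousLinearMap.intervalIntegral_comp_comm _ hi']
  have hco : ContinuousOn (fun t => co κ (u t)) (Icc 0 t) :=
    (co κ).continuous.comp_continuousOn (hu.cont_u.mono hsub)
  have hch : ContinuousOn (fun t => cf κ (h t)) (Icc 0 t) :=
    (cf κ).continuous.comp_continuousOn (hu.cont_h.mono hsub)
  have hcont : ContinuousOn (fun s => -lam κ * co κ (u s) + cf κ (h s)) (Icc 0 t) :=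
    (hco.const_smul (-lam κ)).add hch
  have h1 : ∫ s in (0 : ℝ)..t, cf κ (D 2 (U s) - D 0 (U s) + h s) =
      ∫ s in (0 : ℝ)..t, (-lam κ * co κ (u s) + cf κ (h s)) := by
    rw [intervalIntegral.integral_of_le ht.1, intervalIntegral.integral_of_le ht.1,
      integral_Ioc_eq_integral_Ioo, integral_Ioc_eq_integral_Ioo]
    refine integral_congr_ae ?_
    filter_upwards [ae_restrict_of_ae_restrict_of_subset (Ioo_subset_Ioo_right ht.2) hUu] with s hs
    rw [map_add, map_sub, cf_D2, ← hs, co_apply, D0_toH1, lam]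
    ring
  have hd : ∀ s ∈ Icc 0 t, HasDerivWithinAt (fun s => co κ (u s))
      (-lam κ * co κ (u s) + cf κ (h s)) (Icc 0 t) s :=
    fun s hs => (hu.hasDeriv κ s (hsub hs)).mono hsub
  rw [h1, intervalIntegral.integral_eq_sub_of_hasDeriv_right_of_le ht.1
    (fun s hs => (hd s hs).continuousWithinAt) (fun s hs =>
      (hd s (Ioo_subset_Icc_self hs)).mono_of_mem_nhdsWithin
        (Icc_mem_nhdsGT_of_mem (Ioo_subset_Ico_self hs)))]
  · rw [co_apply, co_apply]
    ring
  · exact ContinuousOn.intervalIntegrable (by rwa [uIcc_of_le ht.1])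

end

section

variable {m : ℕ} {f : E m → (E m →L[ℝ] E m)} {g : E m → E m} {K : ℝ}

theorem IsTame.equation_iff (hK : IsTame f g K) {U : Hper m 2} {v : Hper m 1} (hU : toH1 U = v)
    (w : L2 m) : (∀ᵐ x ∂μ, w x - D 2 U x + D 0 U x + f (D 0 U x) (D 1 U x) + g (D 0 U x) = 0) ↔
      w = D 2 U - D 0 U + nonlin f g v := by
  subst hU
  have h1 : (D 2 U - D 0 U + nonlin f g (toH1 U) : L2 m) =ᵐ[μ] fun x =>
      D 2 U x - D 0 U x + (-f (D 0 U x) (D 1 U x) - g (D 0 U x)) := by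
    filter_upwards [hK.coeFn_nonlin (toH1 U), Lp.coeFn_add (D 2 U - D 0 U) (nonlin f g (toH1 U)),
      Lp.coeFn_sub (D 2 U) (D 0 U)] with x h1 h2 h3
    rw [h2, Pi.add_apply, h3, Pi.sub_apply, h1, D0_toH1, D1_toH1]
  constructor
  · intro h
    refine Lp.ext ?_
    filter_upwards [h, h1] with x hx hx'
    rw [hx', ← sub_eq_zero, ← hx]
    abel
  · rintro rfl
    filter_upwards [h1] with x hx'
    rw [hx']
    abel

theorem IsTame.isSolution_of_isMildSol (hK : IsTame f g K) {T : ℝ} (hT : 0 < T)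
    {u : ℝ → Hper m 1} (hu : IsMildSol f g T u) : IsSolution f g T (u 0) u := by
  obtain ⟨U, hU, hUu⟩ := IsMild.exists_memLp hu hT.le
  obtain ⟨h1, h2⟩ := IsMild.eq_integral hu hT.le hU hUu
  refine ⟨hu.cont_u, rfl, U, _, hU, hUu, h1, h2, ?_⟩
  filter_upwards [hUu] with t ht
  exact (hK.equation_iff ht _).2 rfl

/-- Pairing the integral identity with a basis function leaves an integrand equal a.e. to the
continuous function `R`, so the coefficient is differentiable at every time, not just almost every
one. -/
theorem IsTame.isMildSol_of_isSolution (hK : IsTame f g K) {T : ℝ} (hT : 0 < T) {u₀ : Hper m 1}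
    {u : ℝ → Hper m 1} (hu : IsSolution f g T u₀ u) : IsMildSol f g T u := by
  obtain ⟨hc, h0, U, ut, hU, hUu, hi, hrep, heq⟩ := hu
  have hch : ContinuousOn (fun t => nonlin f g (u t)) (Icc 0 T) :=
    hK.continuous_nonlin.comp_continuousOn hc
  refine ⟨hch, hc, fun κ t ht => ?_⟩
  let R : ℝ → ℝ := fun s => -lam κ * co κ (u s) + cf κ (nonlin f g (u s))
  have hRc : ContinuousOn R (Icc 0 T) :=
    (((co κ).continuous.comp_continuousOn hc).const_smul (-lam κ)).add
      ((cf κ).continuous.comp_continuousOn hch)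
  have hco : ∀ r ∈ Icc 0 T, co κ (u r) = (∫ s in (0 : ℝ)..r, R s) + co κ (u 0) := by
    intro r hr
    have hi' : IntervalIntegrable ut volume 0 r := by
      refine hi.mono_set ?_
      rw [uIcc_of_le hr.1, uIcc_of_le hT.le]
      exact Icc_subset_Icc le_rfl hr.2
    rw [co_apply, hrep r hr, map_add, ← ContinuousLinearMap.intervalIntegral_comp_comm _ hi',
      add_comm, co_apply]
    congr 1
    rw [intervalIntegral.integral_of_le hr.1, intervalIntegral.integral_of_le hr.1,
      integral_Ioc_eq_integral_Ioo, integral_Ioc_eq_integral_Ioo]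
    refine integral_congr_ae ?_
    filter_upwards [ae_restrict_of_ae_restrict_of_subset (Ioo_subset_Ioo_right hr.2) hUu,
      ae_restrict_of_ae_restrict_of_subset (Ioo_subset_Ioo_right hr.2) heq] with s hs hs'
    rw [(hK.equation_iff hs _).1 hs']
    simp only [R]
    rw [map_add, map_sub, cf_D2, ← hs, co_apply, D0_toH1, lam]
    ring
  have : Fact (t ∈ Icc 0 T) := ⟨ht⟩
  have hder : HasDerivWithinAt (fun r => ∫ s in (0 : ℝ)..r, R s) (R t) (Icc 0 T) t := by
    refine intervalIntegral.integral_hasDerivWithinAt_right (t := Icc 0 T) ?_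
      (hRc.stronglyMeasurableAtFilter_nhdsWithin measurableSet_Icc t) (hRc t ht)
    refine (hRc.mono ?_).intervalIntegrable
    rw [uIcc_of_le ht.1]
    exact Icc_subset_Icc le_rfl ht.2
  exact (hder.add_const (co κ (u 0))).congr hco (hco t ht)

end

/-! ### Existence: Duhamel's formula and Picard iteration -/

theorem hasDerivAt_duhamel {a₀ l : ℝ} {b : ℝ → ℝ} (hb : Continuous b) (t : ℝ) :
    HasDerivAt (fun t => Real.exp (-l * t) * (a₀ + ∫ s in (0 : ℝ)..t, Real.exp (l * s) * b s))
      (-l * (Real.exp (-l * t) * (a₀ + ∫ s in (0 : ℝ)..t, Real.exp (l * s) * b s)) + b t) t := by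
  have hc : Continuous fun s => Real.exp (l * s) * b s := by fun_prop
  have h1 : HasDerivAt (fun t => ∫ s in (0 : ℝ)..t, Real.exp (l * s) * b s)
      (Real.exp (l * t) * b t) t := hc.integral_hasStrictDerivAt 0 t |>.hasDerivAt
  have h2 : HasDerivAt (fun t => Real.exp (-l * t)) (Real.exp (-l * t) * (-l)) t := by
    simpa using ((hasDerivAt_id t).const_mul (-l)).exp
  convert! h2.mul (h1.const_add a₀) using 1
  have h3 : Real.exp (-l * t) * Real.exp (l * t) = 1 := by
    rw [← Real.exp_add]
    simp
  linear_combination (-b t) * h3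

/-- The bound is uniform in `t` and summable over modes; it supplies the majorant for continuity in
`H¹`. -/
theorem sq_le_of_hasDerivAt {a b : ℝ → ℝ} {l t T : ℝ} (ht : t ∈ Icc 0 T)
    (hb : Continuous b) (ha : ∀ s, HasDerivAt a (-l * a s + b s) s) :
    l * a t ^ 2 ≤ l * a 0 ^ 2 + ∫ s in (0 : ℝ)..T, b s ^ 2 := by
  have hac : Continuous a := continuous_iff_continuousAt.2 fun s => (ha s).continuousAt
  have hd : ∀ s, HasDerivAt (fun s => l * a s ^ 2) (l * (2 * a s * (-l * a s + b s))) s := by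
    intro s
    convert! ((ha s).pow 2).const_mul l using 1
    simp
  have hint := intervalIntegral.integral_eq_sub_of_hasDerivAt (a := 0) (b := t)
    (fun s _ => hd s) (Continuous.intervalIntegrable (by fun_prop) _ _)
  have h1 : ∫ s in (0 : ℝ)..t, l * (2 * a s * (-l * a s + b s)) ≤ ∫ s in (0 : ℝ)..t, b s ^ 2 := by
    refine intervalIntegral.integral_mono_on ht.1 (Continuous.intervalIntegrable (by fun_prop) _ _)
      (Continuous.intervalIntegrable (by fun_prop) _ _) fun s _ => ?_
    nlinarith [sq_nonneg (l * a s - b s), sq_nonneg (l * a s)]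
  have h2 : ∫ s in (0 : ℝ)..t, b s ^ 2 ≤ ∫ s in (0 : ℝ)..T, b s ^ 2 :=
    intervalIntegral.integral_mono_interval le_rfl ht.1 ht.2
      (ae_of_all _ fun s => sq_nonneg _) (Continuous.intervalIntegrable (by fun_prop) _ _)
  linarith

section

variable {m : ℕ}

/-- Solvability of the linear problem. -/
theorem exists_isMild {T : ℝ} (hT : 0 ≤ T) {h : ℝ → L2 m} (hh : ContinuousOn h (Icc 0 T))
    (u₀ : Hper m 1) : ∃ u : ℝ → Hper m 1, u 0 = u₀ ∧ IsMild T h u := by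
  -- Extending the forcing continuously to `ℝ` makes the Duhamel formula differentiable everywhere.
  let H : ℝ → L2 m := IccExtend hT ((Icc 0 T).domRestrict h)
  have hH : Continuous H := (continuousOn_iff_continuous_domRestrict.1 hh).Icc_extend'
  have hHh : ∀ t ∈ Icc 0 T, H t = h t := fun t ht => by
    simp only [H]
    rw [IccExtend_of_mem hT _ ht, domRestrict_apply]
  have hb : ∀ κ, Continuous fun t => cf κ (H t) := fun κ => (cf κ).continuous.comp hH
  let a : ℤ × Fin m → ℝ → ℝ := fun κ t =>
    Real.exp (-lam κ * t) * (co κ u₀ + ∫ s in (0 : ℝ)..t, Real.exp (lam κ * s) * cf κ (H s))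
  have ha : ∀ κ t, HasDerivAt (a κ) (-lam κ * a κ t + cf κ (H t)) t := fun κ t =>
    hasDerivAt_duhamel (hb κ) t
  have ha0 : ∀ κ, a κ 0 = co κ u₀ := fun κ => by simp [a]
  let M : ℤ × Fin m → ℝ := fun κ => lam κ * co κ u₀ ^ 2 + ∫ s in (0 : ℝ)..T, cf κ (H s) ^ 2
  have haM : ∀ κ, ∀ t ∈ Icc 0 T, lam κ * a κ t ^ 2 ≤ M κ := fun κ t ht => by
    have := sq_le_of_hasDerivAt ht (hb κ) (ha κ)
    rwa [ha0] at this
  have hM : Summable M := by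
    refine (hasSum_norm_H1 u₀).summable.add
      (summable_of_sum_le (c := ∫ s in (0 : ℝ)..T, ‖H s‖ ^ 2)
        (fun κ => intervalIntegral.integral_nonneg hT fun s _ => sq_nonneg _) fun F => ?_)
    rw [← intervalIntegral.integral_finsetSum (f := fun κ s => cf κ (H s) ^ 2) fun κ _ =>
      ((hb κ).pow 2).intervalIntegrable _ _]
    refine intervalIntegral.integral_mono_on hT (Continuous.intervalIntegrable (by fun_prop) _ _)
      (Continuous.intervalIntegrable (by fun_prop) _ _) fun s _ => sum_cf_sq_le _ _
  have hex : ∀ t, ∃ v : Hper m 1, t ∈ Icc 0 T → ∀ κ, co κ v = a κ t := by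
    intro t
    by_cases ht : t ∈ Icc 0 T
    · obtain ⟨v, hv⟩ := exists_H1_of_summable (c := fun κ => a κ t)
        (hM.of_nonneg_of_le (fun κ => mul_nonneg (lam_pos κ).le (sq_nonneg _))
          fun κ => haM κ t ht)
      exact ⟨v, fun _ => hv⟩
    · exact ⟨0, fun h => absurd h ht⟩
  choose u hu using hex
  refine ⟨u, ext_co fun κ => by rw [hu 0 ⟨le_rfl, hT⟩, ha0], hh, ?_, fun κ t ht => ?_⟩
  · refine continuousOn_of_co hM (fun κ => ?_) fun t ht κ => by
      rw [hu t ht]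
      exact haM κ t ht
    have : ContinuousOn (a κ) (Icc 0 T) := fun t _ => (ha κ t).continuousAt.continuousWithinAt
    exact this.congr fun t ht => hu t ht κ
  · rw [hu t ht, ← hHh t ht]
    exact (ha κ t).hasDerivWithinAt.congr (fun s hs => hu s hs κ) (hu t ht κ)

theorem IsMild.norm_sq_le {T : ℝ} {h : ℝ → L2 m} {u : ℝ → Hper m 1} (hu : IsMild T h u)
    {B B' : ℝ → ℝ} (h0 : ‖u 0‖ ^ 2 ≤ B 0) (hB : ∀ t, HasDerivAt B (B' t) t)
    (hh : ∀ t ∈ Icc 0 T, ‖h t‖ ^ 2 ≤ B' t) {t : ℝ} (ht : t ∈ Icc 0 T) : ‖u t‖ ^ 2 ≤ B t :=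
  le_of_upperSlope (hu.cont_u.norm.pow 2)
    (fun s hs => (hu.upperSlope_norm_sq hs).mono (hh s (Ico_subset_Icc_self hs))) h0 hB ht

variable {f : E m → (E m →L[ℝ] E m)} {g : E m → E m} {K : ℝ}

theorem IsTame.exists_isMildSol (hK : IsTame f g K) {T : ℝ} (hT : 0 ≤ T) (u₀ : Hper m 1) :
    ∃ u : ℝ → Hper m 1, u 0 = u₀ ∧ IsMildSol f g T u := by
  obtain ⟨L, hL0, hL⟩ := hK.exists_lipschitz
  have hpi := Real.pi_pos
  -- `G` solves the linear comparison ODE with the growth constants of the nonlinearity; hence `‖v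
  -- t‖² ≤ G t` is preserved by the iteration and no restriction on `T` is needed.
  let G : ℝ → ℝ := gronwallBound (‖u₀‖ ^ 2) (2 * K ^ 2) (2 * Real.pi * (2 * K ^ 2))
  have hG : Monotone G := gronwallBound_mono (sq_nonneg _) (by positivity) (by positivity)
  have hG0 : G 0 = ‖u₀‖ ^ 2 := gronwallBound_x0 _ _ _
  let R : ℝ := √(G T)
  let A : ℝ := L * (1 + R)
  have hA : 0 ≤ A := mul_nonneg hL0 (by positivity)
  -- With the weight `exp (Λt)`, integrating `A² exp (Λt)` gains the factor `A² / Λ = 1/4` at each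
  -- iteration.
  let Λ : ℝ := 4 * A ^ 2
  have hlip : ∀ v w : Hper m 1, ‖w‖ ≤ R → ‖nonlin f g v - nonlin f g w‖ ^ 2 ≤
      A ^ 2 * ‖v - w‖ ^ 2 := by
    intro v w hw
    rw [← mul_pow]
    refine pow_le_pow_left₀ (norm_nonneg _) ((hL v w).trans ?_) 2
    simp only [A]
    gcongr
  have hGR : ∀ v : Hper m 1, ∀ t ∈ Icc 0 T, ‖v‖ ^ 2 ≤ G t → ‖v‖ ≤ R := fun v t ht hv =>
    Real.le_sqrt_of_sq_le (hv.trans (hG ht.2))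
  let X : Type := {v : ℝ → Hper m 1 // ContinuousOn v (Icc 0 T) ∧ v 0 = u₀ ∧
    ∀ t ∈ Icc 0 T, ‖v t‖ ^ 2 ≤ G t}
  have hstep : ∀ v : X, ∃ w : X, IsMild T (fun t => nonlin f g (v.1 t)) w.1 := by
    rintro ⟨v, hvc, -, hvG⟩
    obtain ⟨w, hw0, hw⟩ := exists_isMild hT (hK.continuous_nonlin.comp_continuousOn hvc) u₀
    refine ⟨⟨w, hw.cont_u, hw0, fun t ht => hw.norm_sq_le (by rw [hw0]; exact hG0.ge)
      (fun t => hasDerivAt_gronwallBound _ _ _ t) (fun s hs => ?_) ht⟩, hw⟩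
    refine (hK.norm_nonlin_sq_le (v s)).trans ?_
    have h1 := pow_le_pow_left₀ (norm_nonneg _) (norm_D1_le (v s)) 2
    have h2 := h1.trans (hvG s hs)
    simp only [G] at h2
    gcongr
  choose Θ hΘ using hstep
  let v : ℕ → X := fun n => Θ^[n] ⟨fun _ => u₀, continuousOn_const, rfl, fun t ht => by
    rw [← hG0]
    exact hG ht.1⟩
  have hv : ∀ n, IsMild T (fun t => nonlin f g ((v n).1 t)) (v (n + 1)).1 := by
    intro n
    simp only [v, Function.iterate_succ_apply']
    exact hΘ _
  have hvR : ∀ n, ∀ t ∈ Icc 0 T, ‖(v n).1 t‖ ≤ R := fun n t ht =>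
    hGR _ t ht ((v n).2.2.2 t ht)
  have hdiff : ∀ n, ∀ t ∈ Icc 0 T, ‖(v (n + 1)).1 t - (v n).1 t‖ ^ 2 ≤
      (2 * R) ^ 2 * (1 / 4) ^ n * Real.exp (Λ * t) := by
    intro n
    induction n with
    | zero =>
      intro t ht
      have h1 : ‖(v (0 + 1)).1 t - (v 0).1 t‖ ≤ 2 * R :=
        (norm_sub_le _ _).trans (by linarith [hvR (0 + 1) t ht, hvR 0 t ht])
      have h2 : 1 ≤ Real.exp (Λ * t) := Real.one_le_exp (mul_nonneg (by positivity) ht.1)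
      have h3 := pow_le_pow_left₀ (norm_nonneg _) h1 2
      rw [pow_zero, mul_one]
      exact h3.trans (le_mul_of_one_le_right (sq_nonneg _) h2)
    | succ n ih =>
      intro t ht
      refine ((hv (n + 1)).sub (hv n)).norm_sq_le
        (B := fun t => (2 * R) ^ 2 * (1 / 4) ^ (n + 1) * Real.exp (Λ * t))
        (B' := fun t => (2 * R) ^ 2 * (1 / 4) ^ (n + 1) * (Real.exp (Λ * t) * Λ)) ?_ ?_ ?_ ht
      · rw [(v (n + 1 + 1)).2.2.1, (v (n + 1)).2.2.1, sub_self, norm_zero, zero_pow two_ne_zero]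
        positivity
      · intro s
        simpa using (((hasDerivAt_id s).const_mul Λ).exp).const_mul
          ((2 * R) ^ 2 * (1 / 4) ^ (n + 1))
      · intro s hs
        refine (hlip _ _ (hvR n s hs)).trans ?_
        have := mul_le_mul_of_nonneg_left (ih s hs) (sq_nonneg A)
        refine this.trans (le_of_eq ?_)
        simp only [Λ, pow_succ]
        ring
  let C : ℝ := 2 * R * Real.exp (Λ / 2 * T)
  have hdist : ∀ t ∈ Icc 0 T, ∀ n, dist ((v n).1 t) ((v (n + 1)).1 t) ≤ C * (1 / 2) ^ n := by
    intro t ht n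
    rw [dist_comm, dist_eq_norm]
    refine abs_le_of_sq_le_sq' ?_ (by positivity) |>.2
    refine (hdiff n t ht).trans ?_
    have h1 : Real.exp (Λ * t) ≤ Real.exp (Λ / 2 * T) ^ 2 := by
      rw [← Real.exp_nat_mul]
      refine Real.exp_le_exp.2 ?_
      have := mul_le_mul_of_nonneg_left ht.2 (by positivity : 0 ≤ Λ)
      push_cast
      linarith
    have h2 : ((1 : ℝ) / 4) ^ n = ((1 / 2) ^ n) ^ 2 := by
      rw [← pow_mul, mul_comm, pow_mul]
      norm_num
    rw [h2]
    calc (2 * R) ^ 2 * ((1 / 2) ^ n) ^ 2 * Real.exp (Λ * t) ≤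
        (2 * R) ^ 2 * ((1 / 2) ^ n) ^ 2 * Real.exp (Λ / 2 * T) ^ 2 := by gcongr
      _ = _ := by simp only [C]; ring
  have hlim : ∀ t, ∃ w : Hper m 1, t ∈ Icc 0 T → Tendsto (fun n => (v n).1 t) atTop (𝓝 w) := by
    intro t
    by_cases ht : t ∈ Icc 0 T
    -- The weak derivative relation is a family of closed conditions on Fourier coefficients, hence
    -- `H¹` is complete.
    · have hcl : IsClosed (Hper m 1 : Set (PiLp 2 fun _ : Fin 2 => L2 m)) := by
        have : (Hper m 1 : Set (PiLp 2 fun _ : Fin 2 => L2 m)) =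
            {p | ∀ i : Fin 1, ∀ κ, cf κ (p i.succ) = -κ.1 * cf (refl m κ) (p i.castSucc)} := by
          ext p
          exact forall_congr' fun i => isPerWeakDeriv_iff
        rw [this]
        simp only [ofPred_forall]
        refine isClosed_iInter fun i => isClosed_iInter fun κ => isClosed_eq ?_ ?_ <;> fun_prop
      have : CompleteSpace (Hper m 1) := hcl.completeSpace_coe
      obtain ⟨w, hw⟩ := cauchySeq_tendsto_of_complete
        (cauchySeq_of_le_geometric (1 / 2) C (by norm_num) (hdist t ht))
      exact ⟨w, fun _ => hw⟩
    · exact ⟨0, fun h => absurd h ht⟩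
  choose u hu using hlim
  have hrate : ∀ t ∈ Icc 0 T, ∀ n, ‖u t - (v n).1 t‖ ≤ 2 * C * (1 / 2) ^ n := by
    intro t ht n
    have := dist_le_of_le_geometric_of_tendsto (1 / 2) C (by norm_num) (hdist t ht) (hu t ht) n
    rw [dist_comm, dist_eq_norm] at this
    refine this.trans (le_of_eq ?_)
    ring
  have hpow : Tendsto (fun n : ℕ => 2 * C * (1 / 2 : ℝ) ^ n) atTop (𝓝 0) := by
    simpa using (tendsto_pow_atTop_nhds_zero_of_lt_one (r := (1 / 2 : ℝ)) (by norm_num)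
      (by norm_num)).const_mul (2 * C)
  have hunif : TendstoUniformlyOn (fun n => (v n).1) u atTop (Icc 0 T) := by
    rw [Metric.tendstoUniformlyOn_iff]
    intro ε hε
    filter_upwards [hpow.eventually (gt_mem_nhds hε)] with n hn t ht
    rw [dist_eq_norm]
    exact (hrate t ht n).trans_lt hn
  have huc : ContinuousOn u (Icc 0 T) :=
    hunif.continuousOn (Eventually.of_forall fun n => (v n).2.1).frequently
  -- `w` solves the linear problem forced by the limit `u`; both `w` and `u` are limits of the
  -- iterates, so they agree.
  obtain ⟨w, hw0, hw⟩ := exists_isMild hT (hK.continuous_nonlin.comp_continuousOn huc) u₀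
  have heq : EqOn w u (Icc 0 T) := by
    intro t ht
    have h1 : ∀ n, ‖w t - (v (n + 1)).1 t‖ ^ 2 ≤ A ^ 2 * (2 * C * (1 / 2) ^ n) ^ 2 * t := by
      intro n
      refine (hw.sub (hv n)).norm_sq_le (B := fun t => A ^ 2 * (2 * C * (1 / 2) ^ n) ^ 2 * t)
        (B' := fun _ => A ^ 2 * (2 * C * (1 / 2) ^ n) ^ 2) ?_ ?_ ?_ ht
      · rw [hw0, (v (n + 1)).2.2.1]
        simp
      · intro s
        simpa using (hasDerivAt_id s).const_mul (A ^ 2 * (2 * C * (1 / 2) ^ n) ^ 2)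
      · intro s hs
        refine (hlip _ _ (hvR n s hs)).trans ?_
        have := hrate s hs n
        gcongr
    have h2 : Tendsto (fun n : ℕ => ‖w t - (v (n + 1)).1 t‖ ^ 2) atTop (𝓝 (‖w t - u t‖ ^ 2)) :=
      ((((hu t ht).comp (tendsto_add_atTop_nat 1)).const_sub (w t)).norm.pow 2)
    have h3 : Tendsto (fun n : ℕ => A ^ 2 * (2 * C * (1 / 2 : ℝ) ^ n) ^ 2 * t) atTop (𝓝 0) := by
      simpa using ((hpow.pow 2).const_mul (A ^ 2)).mul_const t
    have h4 := le_of_tendsto_of_tendsto' h2 h3 h1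
    have h5 : ‖w t - u t‖ = 0 := sq_eq_zero_iff.1 (le_antisymm h4 (sq_nonneg _))
    exact sub_eq_zero.1 (norm_eq_zero.1 h5)
  refine ⟨w, hw0, hw.congr (fun t ht => ?_) fun t _ => rfl⟩
  simp only [heq ht, Function.comp_apply]

end

/-! ### Compactness and the abstract attractor theorem -/

theorem isCompact_image_closedBall (m : ℕ) {R : ℝ} (hR : 0 ≤ R) :
    IsCompact (toH1 '' Metric.closedBall (0 : Hper m 2) R) := by
  -- The `H²` ball is a closed subset of a product of compact intervals. On it the `H¹` terms have
  -- the summable majorant `(lam κ)⁻¹ * (2 * R ^ 2)`, so the coordinate topology already controls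
  -- the `H¹` norm.
  let Q : Set (ℤ × Fin m → ℝ) :=
    {c | ∀ F : Finset (ℤ × Fin m), ∑ κ ∈ F, (lam κ + (κ.1 : ℝ) ^ 4) * c κ ^ 2 ≤ R ^ 2}
  have hw : ∀ κ : ℤ × Fin m, 1 ≤ lam κ + (κ.1 : ℝ) ^ 4 := fun κ =>
    (one_le_lam κ).trans (le_add_of_nonneg_right (by positivity))
  have hw2 : ∀ κ : ℤ × Fin m, lam κ ^ 2 ≤ 2 * (lam κ + (κ.1 : ℝ) ^ 4) := fun κ => by
    rw [lam]
    nlinarith [sq_nonneg ((κ.1 : ℝ) ^ 2)]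
  have hQ1 : ∀ c ∈ Q, ∀ κ, (lam κ + (κ.1 : ℝ) ^ 4) * c κ ^ 2 ≤ R ^ 2 := fun c hc κ => by
    simpa using hc {κ}
  have hQc : IsCompact Q := by
    refine (isCompact_univ_pi fun _ => isCompact_Icc (a := -R) (b := R)).of_isClosed_subset ?_ ?_
    · simp only [Q, ofPred_forall]
      refine isClosed_iInter fun F => isClosed_le ?_ continuous_const
      fun_prop
    · intro c hc κ _
      refine abs_le_of_sq_le_sq' ?_ hR
      exact (le_mul_of_one_le_left (sq_nonneg _) (hw κ)).trans (hQ1 c hc κ)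
  have hex : ∀ c, ∃ U : Hper m 2, c ∈ Q → (∀ κ, co κ (toH1 U) = c κ) ∧ ‖U‖ ≤ R := by
    intro c
    by_cases hc : c ∈ Q
    · have hsum : Summable fun κ => (lam κ + (κ.1 : ℝ) ^ 4) * c κ ^ 2 :=
        summable_of_sum_le (fun κ => mul_nonneg (zero_le_one.trans (hw κ)) (sq_nonneg _)) hc
      obtain ⟨U, hU⟩ := exists_H2_of_summable (c := c)
        ((hsum.mul_left 2).of_nonneg_of_le (fun _ => sq_nonneg _) fun κ => by
          rw [mul_pow, ← mul_assoc]
          exact mul_le_mul_of_nonneg_right (hw2 κ) (sq_nonneg _))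
      refine ⟨U, fun _ => ⟨hU, abs_le_of_sq_le_sq' ?_ hR |>.2⟩⟩
      refine le_of_tendsto (hasSum_norm_H2 U) (Eventually.of_forall fun F => ?_)
      simp only [hU]
      exact hc F
    · exact ⟨0, fun h => absurd h hc⟩
  choose Ψ hΨ using hex
  have hcont : ContinuousOn (fun c => toH1 (Ψ c)) Q := by
    refine continuousOn_of_co (M := fun κ => (lam κ)⁻¹ * (2 * R ^ 2))
      ((summable_inv_lam m).mul_right _) (fun κ => ?_) fun c hc κ => ?_
    · exact (continuous_apply κ).continuousOn.congr fun c hc => (hΨ c hc).1 κ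
    · rw [(hΨ c hc).1, le_inv_mul_iff₀ (lam_pos κ)]
      have h1 := mul_le_mul_of_nonneg_right (hw2 κ) (sq_nonneg (c κ))
      have h2 := hQ1 c hc κ
      nlinarith
  convert! hQc.image_of_continuousOn hcont using 1
  ext v
  constructor
  · rintro ⟨U, hU, rfl⟩
    have hc : (fun κ => co κ (toH1 U)) ∈ Q := fun F => by
      refine (sum_le_hasSum F (fun κ _ => mul_nonneg (zero_le_one.trans (hw κ)) (sq_nonneg _))
        (hasSum_norm_H2 U)).trans ?_
      have := mem_closedBall_zero_iff.1 hU
      gcongr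
    exact ⟨_, hc, ext_co fun κ => (hΨ _ hc).1 κ⟩
  · rintro ⟨c, hc, rfl⟩
    exact ⟨Ψ c, mem_closedBall_zero_iff.2 (hΨ c hc).2, rfl⟩

/-- Interpolation: integration by parts gives `‖W‖²_{H¹} = (W - ∂ₓ²W, W)`. -/
theorem norm_sq_toH1_le {m : ℕ} (W : Hper m 2) : ‖toH1 W‖ ^ 2 ≤ 2 * ‖W‖ * ‖D 0 W‖ := by
  have h1 : inner ℝ (D 0 W - D 2 W) (D 0 W) = ‖toH1 W‖ ^ 2 := by
    refine (hasSum_cf_mul_cf (D 0 W - D 2 W) (D 0 W)).unique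
      ((hasSum_norm_H1 (toH1 W)).congr_fun fun κ => ?_)
    rw [map_sub, cf_D2, co_apply, D0_toH1, lam]
    ring
  have hD : ∀ j, ‖D j W‖ ≤ ‖W‖ := fun j => PiLp.norm_apply_le _ j
  rw [← h1]
  refine (real_inner_le_norm _ _).trans (mul_le_mul_of_nonneg_right ?_ (norm_nonneg _))
  exact (norm_sub_le _ _).trans (by linarith [hD 0, hD 2])

/-- A semigroup with a compact absorbing set, on which it is continuous, has a global attractor. -/
theorem exists_isGlobalAttractor {X : Type*} [MetricSpace X] {S : ℝ → X → X} {K : Set X}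
    (hK : IsCompact K) (hadd : ∀ s t : ℝ, 0 ≤ s → 0 ≤ t → ∀ x, S (s + t) x = S s (S t x))
    (hcont : ∀ t, 0 ≤ t → ContinuousOn (S t) K)
    (habs : ∀ B : Set X, Bornology.IsBounded B → ∃ T, 0 ≤ T ∧ ∀ t, T ≤ t → S t '' B ⊆ K) :
    ∃ A, A ⊆ K ∧ IsGlobalAttractor S A := by
  obtain ⟨T₀, hT₀, hKabs⟩ := habs K hK.isBounded
  have hevK : ∀ {τ : ℕ → ℝ} {k : ℕ → X}, Tendsto τ atTop atTop → (∀ n, k n ∈ K) →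
      ∀ᶠ n in atTop, S (τ n) (k n) ∈ K := fun hτ hk =>
    (hτ.eventually_ge_atTop T₀).mono fun n hn => hKabs _ hn ⟨_, hk n, rfl⟩
  -- The ω-limit set of the absorbing set.
  let A : Set X := ⋂ n : ℕ, closure {x | ∃ t : ℝ, (n : ℝ) ≤ t ∧ ∃ k ∈ K, S t k = x}
  have hAmem : ∀ {τ : ℕ → ℝ} {k : ℕ → X} {x : X}, Tendsto τ atTop atTop → (∀ n, k n ∈ K) →
      Tendsto (fun n => S (τ n) (k n)) atTop (𝓝 x) → x ∈ A := fun {τ k x} hτ hk hx =>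
    mem_iInter.2 fun n => mem_closure_of_tendsto hx
      ((hτ.eventually_ge_atTop n).mono fun i hi => ⟨τ i, hi, k i, hk i, rfl⟩)
  have hAseq : ∀ x ∈ A, ∃ (τ : ℕ → ℝ) (k : ℕ → X), Tendsto τ atTop atTop ∧ (∀ n, k n ∈ K) ∧
      Tendsto (fun n => S (τ n) (k n)) atTop (𝓝 x) := by
    intro x hx
    have h : ∀ n : ℕ, ∃ t : ℝ, (n : ℝ) ≤ t ∧ ∃ k ∈ K, dist x (S t k) < 1 / ((n : ℝ) + 1) := by
      intro n
      obtain ⟨y, ⟨t, ht, k, hk, rfl⟩, hy⟩ := Metric.mem_closure_iff.1 (mem_iInter.1 hx n)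
        (1 / ((n : ℝ) + 1)) (by positivity)
      exact ⟨t, ht, k, hk, hy⟩
    choose τ hτ k hk hd using h
    refine ⟨τ, k, tendsto_atTop_mono hτ tendsto_natCast_atTop_atTop, hk, ?_⟩
    rw [tendsto_iff_dist_tendsto_zero]
    refine squeeze_zero (fun _ => dist_nonneg) (fun n => ?_)
      (tendsto_one_div_add_atTop_nhds_zero_nat (𝕜 := ℝ))
    rw [dist_comm]
    exact (hd n).le
  have hcpt : ∀ {τ : ℕ → ℝ} {k : ℕ → X}, Tendsto τ atTop atTop → (∀ n, k n ∈ K) →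
      ∃ x ∈ A, ∃ φ : ℕ → ℕ, StrictMono φ ∧
        Tendsto (fun n => S (τ (φ n)) (k (φ n))) atTop (𝓝 x) := by
    intro τ k hτ hk
    obtain ⟨x, -, φ, hφ, hx⟩ := hK.tendsto_subseq' (hevK hτ hk).frequently
    exact ⟨x, hAmem (hτ.comp hφ.tendsto_atTop) (fun n => hk (φ n)) hx, φ, hφ, hx⟩
  have hAK : A ⊆ K := by
    intro x hx
    obtain ⟨τ, k, hτ, hk, hl⟩ := hAseq x hx
    exact hK.isClosed.mem_of_tendsto hl (hevK hτ hk)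
  have hlimS : ∀ {t : ℝ} {τ : ℕ → ℝ} {k : ℕ → X} {x : X}, 0 ≤ t → Tendsto τ atTop atTop →
      (∀ n, k n ∈ K) → x ∈ K → Tendsto (fun n => S (τ n) (k n)) atTop (𝓝 x) →
      Tendsto (fun n => S (t + τ n) (k n)) atTop (𝓝 (S t x)) := by
    intro t τ k x ht hτ hk hx hl
    have h1 : Tendsto (fun n => S (τ n) (k n)) atTop (𝓝[K] x) :=
      tendsto_nhdsWithin_iff.2 ⟨hl, hevK hτ hk⟩
    refine ((hcont t ht x hx).tendsto.comp h1).congr' ?_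
    filter_upwards [hτ.eventually_ge_atTop 0] with n hn
    exact (hadd t (τ n) ht hn (k n)).symm
  refine ⟨A, hAK, hK.of_isClosed_subset (isClosed_iInter fun _ => isClosed_closure) hAK,
    fun t ht => Subset.antisymm ?_ ?_, fun B hB O hO => ?_⟩
  · rintro _ ⟨x, hx, rfl⟩
    obtain ⟨τ, k, hτ, hk, hl⟩ := hAseq x hx
    exact hAmem (tendsto_atTop_add_const_left _ t hτ) hk (hlimS ht hτ hk (hAK hx) hl)
  -- A preimage of `x` under `S t` is a limit point of the same orbits observed `t` earlier.
  · intro x hx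
    obtain ⟨τ, k, hτ, hk, hl⟩ := hAseq x hx
    obtain ⟨y, hy, φ, hφ, hly⟩ := hcpt (τ := fun n => τ n - t)
      (tendsto_atTop_add_const_right _ (-t) hτ) hk
    have h1 := hlimS ht ((tendsto_atTop_add_const_right _ (-t) hτ).comp hφ.tendsto_atTop)
      (fun n => hk (φ n)) (hAK hy) hly
    refine ⟨y, hy, tendsto_nhds_unique h1 ((hl.comp hφ.tendsto_atTop).congr fun n => ?_)⟩
    simp only [Function.comp_apply]
    congr 1
    ring
  -- `B` lies in the absorbing set at time `T`, so escaping points are `S (τ - T)` of points of `K`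
  -- and accumulate on `A`.
  · obtain ⟨T, hT, hTB⟩ := habs B hB
    by_contra! hcon
    have h : ∀ n : ℕ, ∃ t : ℝ, T + n ≤ t ∧ ∃ b ∈ B, S t b ∉ O := by
      intro n
      obtain ⟨t, ht, hsub⟩ := hcon (T + n) (by positivity)
      obtain ⟨_, ⟨b, hb, rfl⟩, hbO⟩ := not_subset.1 hsub
      exact ⟨t, ht, b, hb, hbO⟩
    choose τ hτ b hb hbO using h
    have hτ' : Tendsto (fun n => τ n - T) atTop atTop :=
      tendsto_atTop_mono (fun n => by linarith [hτ n]) tendsto_natCast_atTop_atTop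
    obtain ⟨x, hx, φ, -, hl⟩ := hcpt hτ' fun n => hTB T le_rfl ⟨b n, hb n, rfl⟩
    obtain ⟨n, hn⟩ := (hl.eventually (mem_nhdsSet_iff_forall.1 hO x hx)).exists
    refine hbO (φ n) ?_
    have h0 : 0 ≤ τ (φ n) - T := by
      have := hτ (φ n)
      have := Nat.cast_nonneg (α := ℝ) (φ n)
      linarith
    rwa [← hadd _ _ h0 hT, sub_add_cancel] at hn

/-! ### The solution semigroup and its attractor -/

section

variable {m : ℕ} {f : E m → (E m →L[ℝ] E m)} {g : E m → E m} {K : ℝ}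

/-- `S t u₀` is the end value of a solution chosen on `[0, t]`; uniqueness makes these choices
consistent for different `t` and gives the semigroup law by time translation. -/
theorem IsTame.exists_semigroup (hK : IsTame f g K) : ∃ S : ℝ → Hper m 1 → Hper m 1,
    (∀ u₀ T, 0 ≤ T → IsMildSol f g T fun t => S t u₀) ∧ (∀ u₀, S 0 u₀ = u₀) ∧
    ∀ s t : ℝ, 0 ≤ s → 0 ≤ t → ∀ u₀, S (s + t) u₀ = S s (S t u₀) := by
  have hex : ∀ (T : ℝ) (u₀ : Hper m 1), ∃ u : ℝ → Hper m 1, 0 ≤ T →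
      u 0 = u₀ ∧ IsMildSol f g T u := by
    intro T u₀
    by_cases hT : 0 ≤ T
    · obtain ⟨u, hu⟩ := hK.exists_isMildSol hT u₀
      exact ⟨u, fun _ => hu⟩
    · exact ⟨0, fun h => absurd h hT⟩
  choose w hw using hex
  have hcons : ∀ u₀ T, ∀ t ∈ Icc 0 T, w t u₀ t = w T u₀ t := fun u₀ T t ht =>
    hK.unique (hw t u₀ ht.1).2 ((hw T u₀ (ht.1.trans ht.2)).2.mono ht.2)
      ((hw t u₀ ht.1).1.trans (hw T u₀ (ht.1.trans ht.2)).1.symm) ⟨ht.1, le_rfl⟩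
  have hsol : ∀ u₀ T, 0 ≤ T → IsMildSol f g T fun t => w t u₀ t := fun u₀ T hT =>
    (hw T u₀ hT).2.congr (fun t ht => by simp only [hcons u₀ T t ht]) (hcons u₀ T)
  refine ⟨fun t u₀ => w t u₀ t, hsol, fun u₀ => (hw 0 u₀ le_rfl).1, fun s t hs ht u₀ => ?_⟩
  refine hK.unique ((hsol u₀ (s + t) (add_nonneg hs ht)).shift ht le_rfl)
    (hsol (w t u₀ t) s hs) ?_ ⟨hs, le_rfl⟩
  simp only [zero_add]
  exact (hw 0 _ le_rfl).1.symm

/-- For `t > 0` the images are bounded in `H²` and depend Lipschitz continuously in `L²` on the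
data; interpolation gives Hölder continuity of exponent `1/2` in `H¹`. -/
theorem IsTame.continuousOn_of_isMildSol (hK : IsTame f g K) {S : ℝ → Hper m 1 → Hper m 1}
    (hS : ∀ u₀ T, 0 ≤ T → IsMildSol f g T fun t => S t u₀) (h0 : ∀ u₀, S 0 u₀ = u₀)
    {s : Set (Hper m 1)} (hs : Bornology.IsBounded s) {t : ℝ} (ht : 0 ≤ t) :
    ContinuousOn (S t) s := by
  rcases ht.eq_or_lt with rfl | htpos
  · exact continuousOn_id.congr fun u₀ _ => h0 u₀
  obtain ⟨r, hr⟩ := hs.exists_norm_le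
  obtain ⟨Q, Cs, hQ, -, hsm⟩ := hK.exists_smoothing
  obtain ⟨L, -, hL⟩ := hK.exists_stable
  have hball : ∀ v ∈ s, ∃ U : Hper m 2, toH1 U = S t v ∧ ‖U‖ ≤ (√t)⁻¹ * Q r + Cs := by
    intro v hv
    obtain ⟨U, hU1, hU2⟩ := hsm t _ (hS v t ht) t ⟨htpos, le_rfl⟩
    refine ⟨U, hU1, hU2.trans ?_⟩
    simp only [h0]
    have := hQ (hr v hv)
    gcongr
  intro u hu
  obtain ⟨R, hR⟩ := isCompact_Icc.exists_bound_of_continuousOn (hS u t ht).cont_u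
  obtain ⟨U, hU1, hU2⟩ := hball u hu
  set e : ℝ := Real.exp ((L * (1 + R)) ^ 2 * t)
  have key : ∀ v ∈ s, ‖S t v - S t u‖ ^ 2 ≤
      2 * (2 * ((√t)⁻¹ * Q r + Cs)) * (√e * ‖v - u‖) := by
    intro v hv
    obtain ⟨V, hV1, hV2⟩ := hball v hv
    have h1 := hL t R _ _ (hS v t ht) (hS u t ht) hR t ⟨ht, le_rfl⟩
    have h2 : ‖D 0 (S t v - S t u)‖ ≤ √e * ‖v - u‖ := by
      refine abs_le_of_sq_le_sq' ?_ (by positivity) |>.2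
      rw [mul_pow, Real.sq_sqrt (Real.exp_pos _).le]
      refine h1.trans ?_
      simp only [h0]
      have := norm_D0_le (v - u)
      gcongr
    have h3 : toH1 (V - U) = S t v - S t u := by
      rw [← hV1, ← hU1]
      rfl
    have h4 := norm_sq_toH1_le (V - U)
    rw [← D0_toH1, h3] at h4
    have h5 : ‖V - U‖ ≤ 2 * ((√t)⁻¹ * Q r + Cs) := (norm_sub_le _ _).trans (by linarith)
    exact h4.trans (mul_le_mul (by linarith) h2 (norm_nonneg _)
      (by linarith [(norm_nonneg _).trans h5]))
  have hlim : Tendsto (fun v => 2 * (2 * ((√t)⁻¹ * Q r + Cs)) * (√e * ‖v - u‖)) (𝓝[s] u)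
      (𝓝 0) := by
    have : Continuous fun v : Hper m 1 => 2 * (2 * ((√t)⁻¹ * Q r + Cs)) * (√e * ‖v - u‖) := by
      fun_prop
    simpa using (this.tendsto u).mono_left nhdsWithin_le_nhds
  have hsq : Tendsto (fun v => ‖S t v - S t u‖ ^ 2) (𝓝[s] u) (𝓝 0) :=
    tendsto_of_tendsto_of_tendsto_of_le_of_le' tendsto_const_nhds hlim
      (Eventually.of_forall fun _ => sq_nonneg _)
      (by filter_upwards [self_mem_nhdsWithin] with v hv using key v hv)
  rw [ContinuousWithinAt, tendsto_iff_norm_sub_tendsto_zero]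
  simpa using hsq.sqrt

theorem IsTame.exists_attractor (hK : IsTame f g K) : ∃ S : ℝ → Hper m 1 → Hper m 1,
    IsSolutionSemigroup f g S ∧ ∃ A : Set (Hper m 1), IsGlobalAttractor S A ∧
      ∃ B : Set (Hper m 2), Bornology.IsBounded B ∧ toH1 '' B = A := by
  obtain ⟨S, hS, h0, hadd⟩ := hK.exists_semigroup
  refine ⟨S, ⟨fun u₀ T hT => ?_, h0, hadd⟩, ?_⟩
  · have := hK.isSolution_of_isMildSol hT (hS u₀ T hT.le)
    rwa [h0] at this
  obtain ⟨Q, Cs, hQ, hCs, hsm⟩ := hK.exists_smoothing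
  have hcpt := isCompact_image_closedBall m (R := Cs + 1) (by linarith)
  obtain ⟨A, hAK, hA⟩ := exists_isGlobalAttractor hcpt hadd
    (fun t ht => hK.continuousOn_of_isMildSol hS h0 hcpt.isBounded ht) fun B hB => by
      obtain ⟨r, hr⟩ := hB.exists_norm_le
      -- Past this time `(√t)⁻¹ * Q r ≤ 1`, so the smoothing bound drops below `Cs + 1`.
      refine ⟨1 + Q r ^ 2, by positivity, ?_⟩
      rintro t ht _ ⟨v, hv, rfl⟩
      have ht0 : 0 < t := by nlinarith [sq_nonneg (Q r)]
      obtain ⟨U, hU1, hU2⟩ := hsm t _ (hS v t ht0.le) t ⟨ht0, le_rfl⟩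
      refine ⟨U, mem_closedBall_zero_iff.2 (hU2.trans ?_), hU1⟩
      simp only [h0]
      have h1 : Q ‖v‖ ≤ √t := (hQ (hr v hv)).trans (Real.le_sqrt_of_sq_le (by linarith))
      have h2 : (√t)⁻¹ * Q ‖v‖ ≤ 1 := by
        rw [inv_mul_le_iff₀ (Real.sqrt_pos.2 ht0)]
        linarith
      linarith
  refine ⟨A, hA, Metric.closedBall 0 (Cs + 1) ∩ toH1 ⁻¹' A,
    Metric.isBounded_closedBall.subset inter_subset_left, ?_⟩
  rw [image_inter_preimage, inter_eq_right]
  exact hAK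

end

end RDA
end

theorem mainTheorem6 (m : ℕ) (f : RDA.E m → (RDA.E m →L[ℝ] RDA.E m)) (g : RDA.E m → RDA.E m)
    (hf : ContDiff ℝ ∞ f) (hf_supp : HasCompactSupport f)
    (hg : ContDiff ℝ ∞ g) (hg_supp : HasCompactSupport g) :
    -- existence and uniqueness on every finite time interval
    (∀ u₀ : RDA.Hper m 1, ∀ T : ℝ, 0 < T →
      ∃ u : ℝ → RDA.Hper m 1, RDA.IsSolution f g T u₀ u ∧
        ∀ v : ℝ → RDA.Hper m 1, RDA.IsSolution f g T u₀ v → EqOn v u (Icc 0 T)) ∧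
    -- dissipativity
    (∃ C γ : ℝ, 0 < C ∧ 0 < γ ∧
      ∀ (u₀ : RDA.Hper m 1) (T : ℝ) (u : ℝ → RDA.Hper m 1), 0 < T → RDA.IsSolution f g T u₀ u →
        ∀ t ∈ Icc 0 T, ‖u t‖ ≤ C * Real.exp (-γ * t) * ‖u₀‖ + C) ∧
    -- smoothing property
    (∃ (Q : ℝ → ℝ) (Cs : ℝ), Monotone Q ∧ 0 < Cs ∧
      ∀ (u₀ : RDA.Hper m 1) (T : ℝ) (u : ℝ → RDA.Hper m 1), 0 < T → RDA.IsSolution f g T u₀ u →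
        ∀ t ∈ Ioc 0 T, ∃ U : RDA.Hper m 2, RDA.toH1 U = u t ∧
          ‖U‖ ≤ t ^ (-(1 / 2) : ℝ) * Q ‖u₀‖ + Cs) ∧
    -- solution semigroup and its global attractor, which is bounded in `H²_per`
    (∃ S : ℝ → RDA.Hper m 1 → RDA.Hper m 1, RDA.IsSolutionSemigroup f g S ∧
      ∃ A : Set (RDA.Hper m 1), RDA.IsGlobalAttractor S A ∧
        ∃ B : Set (RDA.Hper m 2), Bornology.IsBounded B ∧ RDA.toH1 '' B = A) := by
  obtain ⟨K, hK⟩ := RDA.exists_isTame hf hf_supp hg hg_supp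
  refine ⟨fun u₀ T hT => ?_, ?_, ?_, hK.exists_attractor⟩
  · obtain ⟨u, hu0, hu⟩ := hK.exists_isMildSol hT.le u₀
    refine ⟨u, hu0 ▸ hK.isSolution_of_isMildSol hT hu, fun v hv => ?_⟩
    exact hK.unique (hK.isMildSol_of_isSolution hT hv) hu (hv.initial.trans hu0.symm)
  · obtain ⟨C, γ, hC, hγ, h⟩ := hK.exists_dissipative
    refine ⟨C, γ, by linarith, hγ, fun u₀ T u hT hu t ht => ?_⟩
    rw [← hu.initial]
    exact h T u (hK.isMildSol_of_isSolution hT hu) t ht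
  · obtain ⟨Q, Cs, hQ, hCs, h⟩ := hK.exists_smoothing
    refine ⟨Q, Cs, hQ, hCs, fun u₀ T u hT hu t ht => ?_⟩
    obtain ⟨U, hU1, hU2⟩ := h T u (hK.isMildSol_of_isSolution hT hu) t ht
    refine ⟨U, hU1, ?_⟩
    rwa [Real.rpow_neg ht.1.le, ← Real.sqrt_eq_rpow, ← hu.initial]
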